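/- **Setting.** A storage allocation places $k$ objects on $n$ nodes; object $i$ has service choices, each of them a nonempty set of nodes that serve it jointly, and distinct choices of one object are disjoint. Let $T$ be the $0/1$ matrix that adds up the demand portions assigned to the choices of each object, and let $M$ be the $0/1$ matrix by which each portion is loaded on every node of its choice. For a total load $\Sigma>0$ put $\mathcal S_\Sigma=\{\rho\in\mathbb R^k:\rho_i\ge 0,\ \sum_i\rho_i=\Sigma\}$ and $\mathcal C=\{\rho:\exists x\ge 0,\ Tx=\rho,\ Mx<\mathbf 1 \text{ entrywise}\}$. The robustness is $\mathcal P_\Sigma=\mathrm{Vol}_{k-1}(\mathcal C\cap\mathcal S_\Sigma)/\mathrm{Vol}_{k-1}(\mathcal S_\Sigma)$, and the load imbalance factor of $\rho\in\mathcal S_\Sigma$ is $\mathcal I=\min\{\|Mx\|_\infty: Tx=\rho,\ x\ge0\}\,/\,(\Sigma/n)$. A single-choice allocation with $m$ objects per node has $k=mn$; each object is stored on exactly one node and each node stores exactly $m$ objects. Fix an integer $m\ge1$, and for every $n$ a single-choice allocation of $mn$ objects over $n$ nodes with $m$ objects per node, and total loads $\Lambda_n>0$. For each $n$ number the objects node by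 node, so that node $s$ stores the objects numbered $(s-1)m+1,\dots,sm$. Let $U_1,U_2,\dots$ be i.i.d. uniform on $[0,1]$. For each $n\ge1$ let the demand of the object numbered $j$ be $\Lambda_n\,(U_{(j)}-U_{(j-1)})$, $j=1,\dots,mn$, where $U_{(1)}\le\dots\le U_{(mn-1)}$ are the order statistics of $U_1,\dots,U_{mn-1}$, and $U_{(0)}=0$, $U_{(mn)}=1$. Let $\mathcal I_n$ be the load imbalance factor of this demand vector, and $f_n=(m-1)\log\log n-\log((m-1)!)$. **Theorem.** For every $n\ge 1$ the demand vector above is uniformly distributed on $\mathcal S_{\Lambda_n}$, and as $n\to\infty$: 1. $\Pr\{\mathcal I_n\, m-\log n-f_n<x\}\to\exp(-e^{-x})$ for every $x\in\mathbb R$. 2. $(\mathcal I_n\, m-f_n)/\log n\to1$ almost surely. 3. For every sequence $b_n>0$, with $\Sigma_n=b_n\,n/\log n$: $\mathcal P_{\Sigma_n}\to1$ if $\limsup_n b_n<m$, and $\mathcal P_{\Sigma_n}\to0$ if $\liminf_n b_n>m$ (both limits taken in $[0,\infty]$). -/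

import Mathlib

open MeasureTheory ProbabilityTheory Filter
open scoped Topology Matrix

noncomputable section

/-- A storage allocation of `k` objects over `n` nodes: object `i` has `numChoices i` service
choices, and its choice `c` is served jointly by the nodes in `recoverySet i c` (a single node for
an exact copy). Different choices of one object are disjoint. -/
structure StorageAllocation (n k : ℕ) where
  numChoices : Fin k → ℕ
  recoverySet : (i : Fin k) → Fin (numChoices i) → Finset (Fin n)
  recoverySet_nonempty : ∀ i c, (recoverySet i c).Nonempty
  recoverySet_disjoint : ∀ i c c', c ≠ c' → Disjoint (recoverySet i c) (recoverySet i c')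

namespace StorageAllocation

variable {n k : ℕ} (A : StorageAllocation n k)

/-- Indices of the demand portions: one for every service choice of every object. -/
abbrev Portion : Type := (i : Fin k) × Fin (A.numChoices i)

/-- The binary matrix `M`: the load of portion `p` flows into every node of its recovery set. -/
def loadMatrix : Matrix (Fin n) A.Portion ℝ :=
  Matrix.of fun s p => if s ∈ A.recoverySet p.1 p.2 then 1 else 0

/-- The binary matrix `T`: adds up the portions of each object. -/
def demandMatrix : Matrix (Fin k) A.Portion ℝ :=
  Matrix.of fun i p => if p.1 = i then 1 else 0

/-- The service capacity region `{ρ | ∃ x, M x < 1 (entrywise), T x = ρ, x ≥ 0}`. -/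
def capacityRegion : Set (Fin k → ℝ) :=
  {ρ | ∃ x : A.Portion → ℝ,
    (∀ s, (A.loadMatrix *ᵥ x) s < 1) ∧ A.demandMatrix *ᵥ x = ρ ∧ ∀ p, 0 ≤ x p}

/-- The load on the maximally loaded node under an optimal splitting of the demand `ρ`:
the minimum of `‖M x‖_∞` subject to `T x = ρ`, `x ≥ 0` (the norm on `Fin n → ℝ` is the
sup norm). -/
def minMaxLoad (ρ : Fin k → ℝ) : ℝ :=
  sInf {l | ∃ x : A.Portion → ℝ,
    A.demandMatrix *ᵥ x = ρ ∧ (∀ p, 0 ≤ x p) ∧ l = ‖A.loadMatrix *ᵥ x‖}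

/-- The load imbalance factor `I` for demand vector `ρ` of cumulative load `Λ`. -/
def loadImbalance (Λ : ℝ) (ρ : Fin k → ℝ) : ℝ :=
  A.minMaxLoad ρ / (Λ / n)

/-- Node `s` stores object `i`. -/
def Stores (s : Fin n) (i : Fin k) : Prop := ∃ c, s ∈ A.recoverySet i c

/-- Single-choice allocation with `m` objects per node: each object is stored on exactly one node,
and each node stores exactly `m` objects. -/
structure IsSingleChoice (m : ℕ) : Prop where
  numChoices_eq : ∀ i, A.numChoices i = 1
  card_recoverySet : ∀ i c, (A.recoverySet i c).card = 1
  ncard_stored : ∀ s, {i | A.Stores s i}.ncard = m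

end StorageAllocation

/-- The simplex `S_Λ` of demand vectors with cumulative load `Λ`. -/
def demandSimplex (k : ℕ) (Λ : ℝ) : Set (Fin k → ℝ) :=
  {ρ | (∀ i, 0 ≤ ρ i) ∧ ∑ i, ρ i = Λ}

/-- `(k - 1)`-dimensional volume in `ℝ^k` (Hausdorff measure of the Euclidean metric, normalized
as Lebesgue measure). -/
def hyperplaneVolume (k : ℕ) : Measure (Fin k → ℝ) :=
  Measure.map WithLp.ofLp (μHE[k - 1] : Measure (EuclideanSpace ℝ (Fin k)))

/-- The uniform distribution on the simplex `S_Λ`. -/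
def uniformDemand (k : ℕ) (Λ : ℝ) : Measure (Fin k → ℝ) :=
  ProbabilityTheory.cond (hyperplaneVolume k) (demandSimplex k Λ)

/-- The robustness `P_Λ = Volume (C ∩ S_Λ) / Volume S_Λ`. -/
def StorageAllocation.robustness {n k : ℕ} (A : StorageAllocation n k) (Λ : ℝ) : ℝ :=
  (hyperplaneVolume k).real (A.capacityRegion ∩ demandSimplex k Λ) /
    (hyperplaneVolume k).real (demandSimplex k Λ)

/-- Order statistics `u_(1) ≤ … ≤ u_(N)` of `N` points, with `u_(0) = 0` and `u_(i) = 1` for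
`i > N`. -/
def orderStat {N : ℕ} (u : Fin N → ℝ) (i : ℕ) : ℝ :=
  if i = 0 then 0 else if h : i - 1 < N then u (Tuple.sort u ⟨i - 1, h⟩) else 1

/-- The spacings of `N` points in `[0, 1]`, numbered `0, …, N`. -/
def spacing {N : ℕ} (u : Fin N → ℝ) (i : ℕ) : ℝ :=
  orderStat u (i + 1) - orderStat u i

/-- The demand vector of `k` objects with cumulative load `Λ` obtained from the `k` spacings of
the first `k - 1` points of the sequence `u`; object `i` receives the spacing numbered `σ i`. -/
def spacingDemand (k : ℕ) (Λ : ℝ) (σ : Fin k ≃ Fin k) (u : ℕ → ℝ) (i : Fin k) : ℝ :=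
  Λ * spacing (fun l : Fin (k - 1) => u l) (σ i)

/-- The centering `f_n = (m - 1) log log n - log ((m - 1)!)`, for `m ≥ 1`. -/
def centering (m n : ℕ) : ℝ :=
  ((m : ℝ) - 1) * Real.log (Real.log n) - Real.log (Nat.factorial (m - 1))

end

/-!
The idea is that uniform spacings are exponential variables divided by their sum.

Let `u` be `N` independent uniform points of `[0, 1]`. Sorting `u` is, on each of the `N!`
orderings, a permutation of the coordinates, and taking increments is linear; so the first `N`
spacings have a density that is constant on the corner simplex `{v ≥ 0, ∑ v ≤ 1}`
(`map_spacing_eq_cond`). The demand vector is an affine function of these spacings, and an injective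
affine map scales volume by a constant, which disappears on normalization: this gives the uniform
law on the simplex (`uniformDemand_eq_map`). In the same way, the joint density of independent
standard exponential variables depends only on their sum `S`, so the ratios to `S` are uniform on
the simplex, `S` has a gamma distribution, and the two are independent (`pi_expMeasure_ratio_sum`).
Determinants are never computed, since all laws in question are probability measures.

In a single-choice allocation the load of node `s` is forced, and when the objects are numbered node
by node it is `Λ` times the sum of the `m` consecutive spacings that start at number `s m`. The load
imbalance multiplied by `m` is therefore `m n` times the longest of `n` aligned windows
(`loadImbalance_mul_lt_iff`), and the robustness is the probability that this longest window is
shorter than `1 / Λ` (`robustness_eq_blockProb`).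

Replacing spacings by exponential variables costs a factor `S / (m n)`, which Chebyshev's inequality
for the gamma distribution controls (`blockProb_bounds`). Windows of exponential variables are
gamma distributed, with tail `e^(-y) ∑_{j < m} y^j / j!`, and aligned windows are independent; hence
the longest one is below `y` with probability `(1 - tail)^n`, and `n · tail → e^(-x)` when
`y = log n + f_n + x`. This yields the Gumbel limit (`tendsto_blockProb`). The threshold for the
robustness is `(m / b) log n`, which lies outside the Gumbel window on one side or the other
(`tendsto_blockProb_load`).

For the almost sure limit, the probability that the longest window is below `(1 - ε) log n / (m n)`
is at most a constant times `exp (-n^(ε/2))`, so the Borel–Cantelli lemma applies directly. The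
probability of exceeding `(1 + ε) log n / (m n)` is only a small negative power of `n`. There a
union bound over all windows, aligned or not, is used along `n = j^K`, and the gaps between the
members of this sequence are filled by monotonicity: the longest of all windows can only shrink when
points are added (`windowsLt_of_le`), because a window of length `t` is the same as an
interval of length `t` with fewer than `m` points in its interior.
-/

noncomputable section

open scoped Pointwise


/-! ### The corner simplex -/

theorem measurableSet_forall {α ι : Type*} [MeasurableSpace α] [Countable ι] {p : ι → α → Prop}
    (h : ∀ i, MeasurableSet {x | p i x}) : MeasurableSet {x | ∀ i, p i x} := by
  have : {x | ∀ i, p i x} = ⋂ i, {x | p i x} := by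
    ext x
    simp
  exact this ▸ MeasurableSet.iInter h

/-- The corner simplex `{v | 0 ≤ v, ∑ v ≤ 1}` of `ℝ^N`: the projection of the standard simplex of
`ℝ^(N+1)` that forgets the last coordinate. -/
def cornerSimplex (N : ℕ) : Set (Fin N → ℝ) :=
  {v | (∀ i, 0 ≤ v i) ∧ ∑ i, v i ≤ 1}

theorem measurableSet_cornerSimplex (N : ℕ) : MeasurableSet (cornerSimplex N) :=
  (measurableSet_forall fun i => measurableSet_le measurable_const (measurable_pi_apply i)).inter
    (measurableSet_le (f := fun v : Fin N → ℝ => ∑ i, v i) (by fun_prop) measurable_const)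

/-- Only the existence of the constant matters below: it is recovered by normalization. -/
theorem volume_preimage_injective_linearMap {N : ℕ} (f : (Fin N → ℝ) →ₗ[ℝ] (Fin N → ℝ))
    (hf : Function.Injective f) :
    ∃ c : ENNReal, ∀ s : Set (Fin N → ℝ), volume (f ⁻¹' s) = c * volume s := by
  have h : LinearMap.det f ≠ 0 := by
    have := (LinearEquiv.isUnit_det' (LinearEquiv.ofInjectiveEndo f hf)).ne_zero
    rwa [show (LinearEquiv.ofInjectiveEndo f hf : (Fin N → ℝ) →ₗ[ℝ] (Fin N → ℝ)) = f from
      LinearMap.ext fun _ => rfl] at this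
  exact ⟨_, fun s => Measure.addHaar_preimage_linearMap volume h s⟩

/-- A measure that agrees with a constant multiple of `μ` on `s` is the conditioning of `μ` on `s`
as soon as it is a probability measure: normalization determines the constant. -/
theorem eq_cond_of_eq_const_mul {α : Type*} [MeasurableSpace α] {ν μ : Measure α}
    [IsProbabilityMeasure ν] {s : Set α} (hs : MeasurableSet s) (c : ENNReal)
    (h : ∀ B, MeasurableSet B → ν B = c * μ (s ∩ B)) : ν = ProbabilityTheory.cond μ s := by
  have h1 : c * μ s = 1 := by
    have := h Set.univ MeasurableSet.univ
    rw [Set.inter_univ, measure_univ] at this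
    exact this.symm
  have hc : c = (μ s)⁻¹ := ENNReal.eq_inv_of_mul_eq_one_left h1
  ext B hB
  rw [h B hB, ProbabilityTheory.cond_apply hs, hc]

/-! ### Order statistics and spacings of uniform points -/

theorem measurableSet_sort_eq {N : ℕ} (π : Equiv.Perm (Fin N)) :
    MeasurableSet {u : Fin N → ℝ | Tuple.sort u = π} := by
  have : {u : Fin N → ℝ | Tuple.sort u = π} =
      {u | (∀ i j, i ≤ j → u (π i) ≤ u (π j)) ∧
        ∀ i j, i < j → u (π i) = u (π j) → π i < π j} := by
    ext u
    rw [Set.mem_ofPred_eq, eq_comm, Tuple.eq_sort_iff]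
    rfl
  rw [this]
  refine MeasurableSet.inter ?_ ?_
  · exact measurableSet_forall fun i => measurableSet_forall fun j => MeasurableSet.imp
      (MeasurableSet.const _) (measurableSet_le (by fun_prop) (by fun_prop))
  · exact measurableSet_forall fun i => measurableSet_forall fun j => MeasurableSet.imp
      (MeasurableSet.const _) (MeasurableSet.imp
        (measurableSet_eq_fun (by fun_prop) (by fun_prop)) (MeasurableSet.const _))

theorem measurable_comp_sort {N : ℕ} :
    Measurable fun u : Fin N → ℝ => u ∘ Tuple.sort u := by
  intro B hB
  have : (fun u : Fin N → ℝ => u ∘ Tuple.sort u) ⁻¹' B =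
      ⋃ π : Equiv.Perm (Fin N), {u | Tuple.sort u = π} ∩ (fun u => u ∘ π) ⁻¹' B := by
    ext u
    simp
  rw [this]
  refine MeasurableSet.iUnion fun π => (measurableSet_sort_eq π).inter ?_
  exact (measurable_pi_iff.2 fun i => measurable_pi_apply (π i)) hB

theorem measurable_orderStat {N : ℕ} (i : ℕ) :
    Measurable fun u : Fin N → ℝ => orderStat u i := by
  unfold orderStat
  split_ifs with h1 h2
  · exact measurable_const
  · exact (measurable_pi_apply (⟨i - 1, h2⟩ : Fin N)).comp measurable_comp_sort
  · exact measurable_const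

theorem measurable_spacing {N : ℕ} (i : ℕ) :
    Measurable fun u : Fin N → ℝ => spacing u i :=
  (measurable_orderStat (i + 1)).sub (measurable_orderStat i)

/-- The increments `v₀, v₁ - v₀, …` of a vector. -/
def increments (N : ℕ) : (Fin N → ℝ) →ₗ[ℝ] (Fin N → ℝ) where
  toFun v i := v i - if (i : ℕ) = 0 then 0 else v ⟨i - 1, by omega⟩
  map_add' v w := by
    ext i
    by_cases h : (i : ℕ) = 0 <;> simp [h]
    ring
  map_smul' c v := by
    ext i
    by_cases h : (i : ℕ) = 0 <;> simp [h]
    ring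

theorem increments_apply {N : ℕ} (v : Fin N → ℝ) (i : Fin N) :
    increments N v i = v i - if (i : ℕ) = 0 then 0 else v ⟨i - 1, by omega⟩ := rfl

theorem sum_increments {N : ℕ} (v : Fin N → ℝ) (k : ℕ) (hk : k < N) :
    ∑ i : Fin (k + 1), increments N v ⟨i, by omega⟩ = v ⟨k, hk⟩ := by
  induction k with
  | zero => simp [increments_apply]
  | succ k ih =>
    rw [Fin.sum_univ_castSucc]
    simp only [Fin.val_castSucc, Fin.val_last]
    rw [ih (by omega), increments_apply]
    simp

theorem increments_injective (N : ℕ) : Function.Injective (increments N) := by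
  intro v w h
  ext i
  rw [← sum_increments v i i.2, ← sum_increments w i i.2, h]

theorem increments_mem_cornerSimplex {N : ℕ} (v : Fin N → ℝ) :
    increments N v ∈ cornerSimplex N ↔
      v ∈ Set.univ.pi (fun _ => Set.Icc (0 : ℝ) 1) ∧ Monotone v := by
  rcases N with _ | N
  · simp [cornerSimplex, Subsingleton.monotone]
  have hlast := sum_increments v N (by omega)
  constructor
  · rintro ⟨h0, h1⟩
    have hmono : Monotone v := by
      refine Fin.monotone_iff_le_succ.2 fun i => ?_
      have := h0 i.succ
      rw [increments_apply] at this
      simp only [Fin.val_succ, Nat.add_one_ne_zero, if_false, Nat.add_sub_cancel] at this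
      exact sub_nonneg.1 this
    have hz : 0 ≤ v 0 := by simpa [increments_apply] using h0 0
    have hl : v ⟨N, by omega⟩ ≤ 1 := hlast ▸ h1
    exact ⟨fun i _ => ⟨hz.trans (hmono (Fin.zero_le i)),
      (hmono (Fin.le_last i)).trans hl⟩, hmono⟩
  · rintro ⟨hc, hm⟩
    refine ⟨fun i => ?_, ?_⟩
    · rw [increments_apply]
      split_ifs with h
      · simpa using (hc i trivial).1
      · exact sub_nonneg.2 (hm (Fin.mk_le_of_le_val (Nat.sub_le _ _)))
    · exact hlast.trans_le (hc _ trivial).2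

theorem spacing_eq_increments {N : ℕ} (u : Fin N → ℝ) (i : Fin N) :
    spacing u i = increments N (u ∘ Tuple.sort u) i := by
  rw [increments_apply]
  have h : (i : ℕ) - 1 < N := by omega
  simp [spacing, orderStat, h]

theorem ae_injective (N : ℕ) :
    ∀ᵐ u : Fin N → ℝ, Function.Injective u := by
  have : ∀ i j : Fin N, i ≠ j → ∀ᵐ u : Fin N → ℝ, u i ≠ u j := by
    intro i j hij
    let f : (Fin N → ℝ) →ₗ[ℝ] ℝ := LinearMap.proj (R := ℝ) (φ := fun _ : Fin N => ℝ) i -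
      LinearMap.proj (R := ℝ) (φ := fun _ : Fin N => ℝ) j
    have hf (u : Fin N → ℝ) : f u = u i - u j := rfl
    have := Measure.addHaar_submodule (volume : Measure (Fin N → ℝ)) (LinearMap.ker f) (by
      intro h
      have h2 : (Pi.single i 1 : Fin N → ℝ) ∈ LinearMap.ker f := by
        rw [h]
        trivial
      simp [hf, hij.symm] at h2)
    rw [ae_iff]
    convert this using 2
    ext u
    simp [hf, sub_eq_zero]
  have h2 : ∀ᵐ u : Fin N → ℝ, ∀ i j : Fin N, i ≠ j → u i ≠ u j :=
    ae_all_iff.2 fun i => ae_all_iff.2 fun j => by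
      by_cases h : i = j
      · simp [h]
      · simpa [h] using this i j h
  filter_upwards [h2] with u hu i j hij
  by_contra h
  exact hu i j h hij

/-- All `N!` orderings of the points contribute equally to the law of the increments of the order
statistics. -/
theorem volume_increments_sort {N : ℕ} {B : Set (Fin N → ℝ)} (hB : MeasurableSet B) :
    volume.restrict (Set.univ.pi fun _ : Fin N => Set.Icc (0 : ℝ) 1)
        {u | increments N (u ∘ Tuple.sort u) ∈ B} =
      Fintype.card (Equiv.Perm (Fin N)) * volume (increments N ⁻¹' (cornerSimplex N ∩ B)) := by
  have hD : Measurable (increments N) :=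
    (LinearMap.continuous_of_finiteDimensional (increments N)).measurable
  have hBm : MeasurableSet {u : Fin N → ℝ | increments N (u ∘ Tuple.sort u) ∈ B} :=
    (hD.comp measurable_comp_sort) hB
  have hcomp (π : Equiv.Perm (Fin N)) :
      MeasurePreserving (fun u : Fin N → ℝ => u ∘ π) volume volume := by
    have := volume_measurePreserving_piCongrLeft (fun _ : Fin N => ℝ) π.symm
    convert this using 1
    ext u i
    have := Equiv.piCongrLeft_apply_apply (fun _ : Fin N => ℝ) π.symm u (π i)
    simpa [MeasurableEquiv.coe_piCongrLeft] using this.symm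
  rw [Measure.restrict_apply hBm]
  set S := {u : Fin N → ℝ | increments N (u ∘ Tuple.sort u) ∈ B} ∩
    Set.univ.pi fun _ : Fin N => Set.Icc (0 : ℝ) 1 with hS
  have hSm : MeasurableSet S := hBm.inter (MeasurableSet.univ_pi fun _ => measurableSet_Icc)
  have hpart : S = ⋃ π : Equiv.Perm (Fin N), S ∩ {u | Tuple.sort u = π} := by
    ext u
    simp
  have hpiece (π : Equiv.Perm (Fin N)) : volume (S ∩ {u | Tuple.sort u = π}) =
      volume (increments N ⁻¹' (cornerSimplex N ∩ B)) := by
    rw [← (hcomp π).measure_preimage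
      (hD ((measurableSet_cornerSimplex N).inter hB)).nullMeasurableSet]
    refine measure_congr ?_
    filter_upwards [ae_injective N] with u hu
    refine propext ?_
    change (_ ∧ _) ↔ increments N (u ∘ π) ∈ cornerSimplex N ∧ increments N (u ∘ π) ∈ B
    rw [increments_mem_cornerSimplex]
    have hmem : u ∘ π ∈ Set.univ.pi (fun _ => Set.Icc (0 : ℝ) 1) ↔
        u ∈ Set.univ.pi (fun _ => Set.Icc (0 : ℝ) 1) := by
      simp only [Set.mem_univ_pi, Function.comp]
      exact ⟨fun h i => by simpa using h (π.symm i), fun h i => h _⟩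
    have hsort : Tuple.sort u = π ↔ Monotone (u ∘ π) := by
      rw [eq_comm, Tuple.eq_sort_iff]
      refine ⟨fun h => h.1, fun h => ⟨h, fun i j hij he => ?_⟩⟩
      exact absurd (π.injective (hu he)) hij.ne
    rw [hmem, ← hsort]
    constructor
    · rintro ⟨⟨h1, h2⟩, h3⟩
      have h3' : Tuple.sort u = π := h3
      have h1' : increments N (u ∘ Tuple.sort u) ∈ B := h1
      rw [h3'] at h1'
      exact ⟨⟨h2, h3⟩, h1'⟩
    · rintro ⟨⟨h2, h3⟩, h1⟩
      refine ⟨⟨?_, h2⟩, h3⟩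
      rw [← h3] at h1
      exact h1
  rw [hpart, measure_iUnion]
  · simp only [hpiece]
    rw [tsum_fintype]
    simp
  · intro π π' h
    refine Set.disjoint_left.2 ?_
    rintro u ⟨_, h1⟩ ⟨_, h2⟩
    exact h (h1.symm.trans h2)
  · exact fun π => hSm.inter (measurableSet_sort_eq π)

instance isProbabilityMeasure_restrict_cube (N : ℕ) : IsProbabilityMeasure
    (volume.restrict (Set.univ.pi fun _ : Fin N => Set.Icc (0 : ℝ) 1)) :=
  ⟨by rw [Measure.restrict_apply_univ, volume_pi_pi]; simp⟩

/-- The first `N` spacings of `N` independent uniform points are uniformly distributed on the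
corner simplex. -/
theorem map_spacing_eq_cond (N : ℕ) :
    Measure.map (fun (u : Fin N → ℝ) (i : Fin N) => spacing u i)
        (volume.restrict (Set.univ.pi fun _ : Fin N => Set.Icc (0 : ℝ) 1)) =
      ProbabilityTheory.cond volume (cornerSimplex N) := by
  have hm : Measurable fun (u : Fin N → ℝ) (i : Fin N) => spacing u i :=
    measurable_pi_iff.2 fun i => measurable_spacing i
  obtain ⟨c, hc⟩ := volume_preimage_injective_linearMap _ (increments_injective N)
  have := Measure.isProbabilityMeasure_map (μ := volume.restrict
    (Set.univ.pi fun _ : Fin N => Set.Icc (0 : ℝ) 1)) hm.aemeasurable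
  refine eq_cond_of_eq_const_mul (measurableSet_cornerSimplex N)
    (Fintype.card (Equiv.Perm (Fin N)) * c) fun B hB => ?_
  rw [Measure.map_apply hm hB, mul_assoc, ← hc, ← volume_increments_sort hB]
  congr 1
  ext u
  simp only [Set.mem_preimage, Set.mem_ofPred_eq]
  rw [show (fun i : Fin N => spacing u i) = increments N (u ∘ Tuple.sort u) from
    funext fun i => spacing_eq_increments u i]


/-! ### The volume of the simplex of demand vectors -/

/-- The point of the standard simplex of `ℝ^(N+1)` whose first `N` coordinates are `v`. -/
def simplexLift {N : ℕ} (v : Fin N → ℝ) : Fin (N + 1) → ℝ :=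
  Fin.snoc (α := fun _ => ℝ) v (1 - ∑ i, v i)

theorem simplexLift_castSucc {N : ℕ} (v : Fin N → ℝ) (i : Fin N) :
    simplexLift v i.castSucc = v i := Fin.snoc_castSucc (α := fun _ => ℝ) _ _ _

theorem simplexLift_last {N : ℕ} (v : Fin N → ℝ) :
    simplexLift v (Fin.last N) = 1 - ∑ i, v i := Fin.snoc_last (α := fun _ => ℝ) _ _

theorem sum_simplexLift {N : ℕ} (v : Fin N → ℝ) : ∑ i, simplexLift v i = 1 := by
  rw [Fin.sum_univ_castSucc, simplexLift_last]
  simp [simplexLift_castSucc]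

theorem simplexLift_nonneg_iff {N : ℕ} (v : Fin N → ℝ) :
    (∀ i, 0 ≤ simplexLift v i) ↔ v ∈ cornerSimplex N := by
  rw [Fin.forall_fin_succ']
  simp [simplexLift_castSucc, simplexLift_last, cornerSimplex]

theorem measurable_simplexLift {N : ℕ} :
    Measurable (simplexLift : (Fin N → ℝ) → Fin (N + 1) → ℝ) := by
  refine measurable_pi_iff.2 fun i => ?_
  refine Fin.lastCases ?_ (fun i => ?_) i
  · simp only [simplexLift_last]
    fun_prop
  · simp only [simplexLift_castSucc]
    fun_prop

/-- All `N + 1` spacings are determined by the first `N` of them. -/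
theorem spacing_eq_simplexLift {N : ℕ} (u : Fin N → ℝ) (i : Fin (N + 1)) :
    spacing u i = simplexLift (fun j : Fin N => spacing u j) i := by
  refine Fin.lastCases ?_ (fun i => ?_) i
  · rw [simplexLift_last]
    rw [Fin.sum_univ_eq_sum_range (fun j => spacing u j) N]
    simp only [spacing]
    rw [Finset.sum_range_sub]
    simp [orderStat]
  · rw [simplexLift_castSucc, Fin.val_castSucc]

/-- The demand vector with cumulative load `Λ` in which object `i` receives the share number `σ i`
of the point of the standard simplex above `v`. -/
def demandOf {N : ℕ} (Λ : ℝ) (σ : Fin (N + 1) ≃ Fin (N + 1)) (v : Fin N → ℝ) : Fin (N + 1) → ℝ :=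
  fun i => Λ * simplexLift v (σ i)

theorem measurable_demandOf {N : ℕ} (Λ : ℝ) (σ : Fin (N + 1) ≃ Fin (N + 1)) :
    Measurable (demandOf Λ σ) :=
  measurable_pi_iff.2 fun i =>
    ((measurable_pi_apply (σ i)).comp measurable_simplexLift).const_mul Λ

/-- The linear part of the affine map `demandOf Λ σ`, between Euclidean spaces. -/
def demandLinear {N : ℕ} (Λ : ℝ) (σ : Fin (N + 1) ≃ Fin (N + 1)) :
    EuclideanSpace ℝ (Fin N) →ₗ[ℝ] EuclideanSpace ℝ (Fin (N + 1)) where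
  toFun v := WithLp.toLp 2 fun i => demandOf Λ σ v.ofLp i - demandOf Λ σ 0 i
  map_add' v w := by
    ext i
    simp only [demandOf, PiLp.add_apply]
    generalize σ i = j
    refine Fin.lastCases ?_ (fun j => ?_) j
    · simp only [simplexLift_last, WithLp.ofLp_add, Pi.add_apply, Finset.sum_add_distrib,
        Pi.zero_apply, Finset.sum_const_zero]
      ring
    · simp [simplexLift_castSucc, mul_add]
  map_smul' c v := by
    ext i
    simp only [demandOf, PiLp.smul_apply, smul_eq_mul, RingHom.id_apply]
    generalize σ i = j
    refine Fin.lastCases ?_ (fun j => ?_) j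
    · simp only [simplexLift_last, WithLp.ofLp_smul, Pi.smul_apply, smul_eq_mul, ← Finset.mul_sum,
        Pi.zero_apply, Finset.sum_const_zero]
      ring
    · simp only [simplexLift_castSucc, WithLp.ofLp_smul, Pi.smul_apply, smul_eq_mul, Pi.zero_apply]
      ring

theorem demandOf_injective {N : ℕ} {Λ : ℝ} (hΛ : 0 < Λ) (σ : Fin (N + 1) ≃ Fin (N + 1)) :
    Function.Injective (demandOf Λ σ) := by
  intro v w h
  ext j
  have := congrFun h (σ.symm j.castSucc)
  simp only [demandOf, Equiv.apply_symm_apply, simplexLift_castSucc] at this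
  exact mul_left_cancel₀ hΛ.ne' this

theorem demandOf_mem_demandSimplex {N : ℕ} {Λ : ℝ} (hΛ : 0 < Λ) (σ : Fin (N + 1) ≃ Fin (N + 1))
    (v : Fin N → ℝ) : demandOf Λ σ v ∈ demandSimplex (N + 1) Λ ↔ v ∈ cornerSimplex N := by
  rw [← simplexLift_nonneg_iff]
  have hs : ∑ i, demandOf Λ σ v i = Λ := by
    simp only [demandOf]
    rw [← Finset.mul_sum, Equiv.sum_comp σ (simplexLift v), sum_simplexLift, mul_one]
  constructor
  · intro h i
    have := h.1 (σ.symm i)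
    simp only [demandOf, Equiv.apply_symm_apply] at this
    exact nonneg_of_mul_nonneg_right this hΛ
  · exact fun h => ⟨fun i => mul_nonneg hΛ.le (h _), hs⟩

theorem exists_demandOf_eq {N : ℕ} {Λ : ℝ} (hΛ : 0 < Λ) (σ : Fin (N + 1) ≃ Fin (N + 1))
    {ρ : Fin (N + 1) → ℝ} (hρ : ρ ∈ demandSimplex (N + 1) Λ) : ∃ v, demandOf Λ σ v = ρ := by
  refine ⟨fun j => ρ (σ.symm j.castSucc) / Λ, funext fun i => ?_⟩
  obtain ⟨j, rfl⟩ := σ.symm.surjective i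
  simp only [demandOf, Equiv.apply_symm_apply]
  refine Fin.lastCases ?_ (fun j => ?_) j
  · have hs : ∑ i, ρ (σ.symm i) = Λ := (Equiv.sum_comp σ.symm ρ).trans hρ.2
    rw [Fin.sum_univ_castSucc] at hs
    rw [simplexLift_last, ← Finset.sum_div, mul_sub, mul_div_cancel₀ _ hΛ.ne']
    linarith
  · rw [simplexLift_castSucc, mul_div_cancel₀ _ hΛ.ne']

theorem measurableSet_demandSimplex (k : ℕ) (Λ : ℝ) : MeasurableSet (demandSimplex k Λ) :=
  (measurableSet_forall fun i => measurableSet_le measurable_const (measurable_pi_apply i)).inter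
    (measurableSet_eq_fun (f := fun v : Fin k → ℝ => ∑ i, v i) (by fun_prop) measurable_const)

/-- An injective affine map scales volume by a constant factor, so the volume on the simplex is a
multiple of the Lebesgue measure on the corner simplex. -/
theorem exists_hyperplaneVolume_eq {N : ℕ} {Λ : ℝ} (hΛ : 0 < Λ)
    (σ : Fin (N + 1) ≃ Fin (N + 1)) :
    ∃ c : ENNReal, c ≠ 0 ∧ c ≠ ⊤ ∧ ∀ B : Set (Fin (N + 1) → ℝ), MeasurableSet B →
      hyperplaneVolume (N + 1) (demandSimplex (N + 1) Λ ∩ B) =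
        c * volume (cornerSimplex N ∩ demandOf Λ σ ⁻¹' B) := by
  refine ⟨ENNReal.ofReal (demandLinear Λ σ).normDet, ?_, ENNReal.ofReal_ne_top, fun B hB => ?_⟩
  · have hinj : Function.Injective (demandLinear Λ σ) := by
      intro v w h
      have h' : ∀ i, demandOf Λ σ v.ofLp i - demandOf Λ σ 0 i =
          demandOf Λ σ w.ofLp i - demandOf Λ σ 0 i := fun i =>
        congrFun (congrArg WithLp.ofLp h) i
      refine WithLp.ofLp_injective 2 (demandOf_injective hΛ σ (funext fun i => ?_))
      simpa using h' i
    have h0 : (demandLinear Λ σ).normDet ≠ 0 :=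
      ((demandLinear Λ σ).normDet_ne_zero_tfae.out 0 4).2 hinj
    have := LinearMap.normDet_nonneg (demandLinear Λ σ)
    simpa using this.lt_of_ne' h0
  · rw [hyperplaneVolume, Measure.map_apply (WithLp.measurable_ofLp 2 _)
      ((measurableSet_demandSimplex _ _).inter hB), Nat.add_sub_cancel]
    have himg : (WithLp.ofLp : EuclideanSpace ℝ (Fin (N + 1)) → _) ⁻¹'
          (demandSimplex (N + 1) Λ ∩ B) =
        (WithLp.toLp 2 (demandOf Λ σ 0) : EuclideanSpace ℝ (Fin (N + 1))) +ᵥ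
          (demandLinear Λ σ '' ((WithLp.ofLp : EuclideanSpace ℝ (Fin N) → _) ⁻¹'
            (cornerSimplex N ∩ demandOf Λ σ ⁻¹' B))) := by
      have hval (v : EuclideanSpace ℝ (Fin N)) :
          (WithLp.toLp 2 (demandOf Λ σ 0) : EuclideanSpace ℝ (Fin (N + 1))) +ᵥ
            demandLinear Λ σ v = WithLp.toLp 2 (demandOf Λ σ v.ofLp) := by
        ext i
        simp [demandLinear]
      ext ρ
      rw [Set.mem_vadd_set]
      constructor
      · rintro ⟨h1, h2⟩
        obtain ⟨v, hv⟩ := exists_demandOf_eq hΛ σ h1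
        refine ⟨_, ⟨WithLp.toLp 2 v, ⟨?_, ?_⟩, rfl⟩, ?_⟩
        · exact (demandOf_mem_demandSimplex hΛ σ v).1 (hv ▸ h1)
        · change demandOf Λ σ v ∈ B
          exact hv ▸ h2
        · rw [hval, hv]
      · rintro ⟨_, ⟨v, ⟨h1, h2⟩, rfl⟩, rfl⟩
        rw [hval]
        exact ⟨(demandOf_mem_demandSimplex hΛ σ _).2 h1, h2⟩
    rw [himg, measure_vadd]
    have hv := (demandLinear Λ σ).euclideanHausdorffMeasure_image_eq_normDet_mul_volume
      ((WithLp.ofLp : EuclideanSpace ℝ (Fin N) → _) ⁻¹'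
            (cornerSimplex N ∩ demandOf Λ σ ⁻¹' B))
    rw [finrank_euclideanSpace_fin] at hv
    rw [hv, (PiLp.volume_preserving_ofLp (Fin N)).measure_preimage
      ((measurableSet_cornerSimplex N).inter (measurable_demandOf Λ σ hB)).nullMeasurableSet]

theorem uniformDemand_eq_map {N : ℕ} {Λ : ℝ} (hΛ : 0 < Λ) (σ : Fin (N + 1) ≃ Fin (N + 1)) :
    uniformDemand (N + 1) Λ =
      Measure.map (demandOf Λ σ) (ProbabilityTheory.cond volume (cornerSimplex N)) := by
  obtain ⟨c, hc0, hct, hc⟩ := exists_hyperplaneVolume_eq hΛ σ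
  ext B hB
  rw [Measure.map_apply (measurable_demandOf Λ σ) hB, uniformDemand,
    ProbabilityTheory.cond_apply (measurableSet_demandSimplex _ _),
    ProbabilityTheory.cond_apply (measurableSet_cornerSimplex N), hc B hB]
  have h1 := hc Set.univ MeasurableSet.univ
  rw [Set.inter_univ, Set.preimage_univ, Set.inter_univ] at h1
  rw [h1, ENNReal.mul_inv (Or.inl hc0) (Or.inl hct), mul_comm c⁻¹, mul_assoc, ← mul_assoc c⁻¹,
    ENNReal.inv_mul_cancel hc0 hct, one_mul]

/-- The law of the vector of demands built from the spacings of independent uniform points. -/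
theorem map_spacingDemand_eq_uniformDemand {N : ℕ} {Λ : ℝ} (hΛ : 0 < Λ)
    (σ : Fin (N + 1) ≃ Fin (N + 1)) :
    Measure.map (fun (u : Fin N → ℝ) (i : Fin (N + 1)) => Λ * spacing u (σ i))
      (volume.restrict (Set.univ.pi fun _ : Fin N => Set.Icc (0 : ℝ) 1)) =
      uniformDemand (N + 1) Λ := by
  rw [uniformDemand_eq_map hΛ σ, ← map_spacing_eq_cond,
    Measure.map_map (measurable_demandOf Λ σ)
      (measurable_pi_iff.2 fun i => measurable_spacing (i : ℕ))]
  congr 1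
  ext u i
  simp only [Function.comp, demandOf, spacing_eq_simplexLift u]


/-! ### The gamma distribution with integer shape -/

/-- The gamma density with integer exponents; Mathlib writes it with real powers and the gamma
function. -/
theorem gammaMeasure_nat_apply (N : ℕ) {C : Set ℝ} (hC : MeasurableSet C) :
    gammaMeasure ((N + 1 : ℕ) : ℝ) 1 C =
      ∫⁻ s in Set.Ioi 0,
        C.indicator (fun s => ENNReal.ofReal (Real.exp (-s) * s ^ N / N.factorial)) s := by
  rw [gammaMeasure, withDensity_apply _ hC, ← lintegral_indicator hC,
    ← lintegral_indicator measurableSet_Ioi]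
  refine lintegral_congr_ae ?_
  filter_upwards [Measure.ae_ne (volume : Measure ℝ) 0] with s hs
  by_cases h0 : 0 < s
  · rw [Set.indicator_of_mem (show s ∈ Set.Ioi 0 from h0)]
    by_cases h : s ∈ C
    · rw [Set.indicator_of_mem h, Set.indicator_of_mem h, gammaPDF_of_nonneg h0.le]
      congr 1
      push_cast
      rw [Real.Gamma_nat_eq_factorial, add_sub_cancel_right, Real.rpow_natCast, one_mul,
        Real.one_rpow]
      ring
    · simp [h]
  · rw [Set.indicator_of_notMem (show s ∉ Set.Ioi 0 from h0)]
    by_cases h : s ∈ C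
    · rw [Set.indicator_of_mem h, gammaPDF_of_neg (lt_of_le_of_ne (not_lt.1 h0) hs)]
    · simp [h]

theorem integrableOn_exp_neg_mul_pow (n : ℕ) :
    IntegrableOn (fun x : ℝ => Real.exp (-x) * x ^ n) (Set.Ioi 0) := by
  have := Real.GammaIntegral_convergent (s := n + 1) (by positivity)
  simpa using this

theorem integral_exp_neg_mul_pow (n : ℕ) :
    ∫ x in Set.Ioi (0 : ℝ), Real.exp (-x) * x ^ n = n.factorial := by
  have := Real.Gamma_eq_integral (s := n + 1) (by positivity)
  rw [Real.Gamma_nat_eq_factorial] at this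
  simpa using this.symm

/-- The gamma distribution with shape `k` has mean and variance `k`, so Chebyshev's inequality
shows that it is concentrated around `k`. -/
theorem gammaMeasure_deviation_le (N : ℕ) {η : ℝ} (hη : 0 < η) :
    (gammaMeasure ((N + 1 : ℕ) : ℝ) 1).real
        {s | η * (N + 1 : ℕ) ≤ |s - (N + 1 : ℕ)|} ≤ 1 / ((N + 1 : ℕ) * η ^ 2) := by
  set k : ℝ := ((N + 1 : ℕ) : ℝ) with hk
  have hk0 : 0 < k := by positivity
  have hC : MeasurableSet {s : ℝ | η * k ≤ |s - k|} := measurableSet_le (by fun_prop) (by fun_prop)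
  have hfac : (0 : ℝ) < N.factorial := by positivity
  set g : ℝ → ℝ := fun s =>
    (s - k) ^ 2 / (η * k) ^ 2 * (Real.exp (-s) * s ^ N / N.factorial) with hg
  have hgeq (s : ℝ) : g s = (1 / ((η * k) ^ 2 * N.factorial)) *
      (Real.exp (-s) * s ^ (N + 2) + ((-2 * k) * (Real.exp (-s) * s ^ (N + 1)) +
        k ^ 2 * (Real.exp (-s) * s ^ N))) := by
    rw [hg]
    field_simp
    ring
  have hi1 : IntegrableOn (fun s : ℝ => (-2 * k) * (Real.exp (-s) * s ^ (N + 1)) +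
        k ^ 2 * (Real.exp (-s) * s ^ N)) (Set.Ioi 0) :=
    ((integrableOn_exp_neg_mul_pow (N + 1)).const_mul _).add
      ((integrableOn_exp_neg_mul_pow N).const_mul _)
  have hint : IntegrableOn g (Set.Ioi 0) := by
    refine IntegrableOn.congr_fun ?_ (fun s _ => (hgeq s).symm) measurableSet_Ioi
    exact Integrable.const_mul (Integrable.add (integrableOn_exp_neg_mul_pow (N + 2)) hi1) _
  have hval : ∫ s in Set.Ioi (0 : ℝ), g s = 1 / (k * η ^ 2) := by
    simp_rw [hgeq]
    rw [integral_const_mul, integral_add (integrableOn_exp_neg_mul_pow (N + 2)) hi1,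
      integral_add ((integrableOn_exp_neg_mul_pow (N + 1)).const_mul _)
      ((integrableOn_exp_neg_mul_pow N).const_mul _), integral_const_mul, integral_const_mul,
      integral_exp_neg_mul_pow, integral_exp_neg_mul_pow, integral_exp_neg_mul_pow,
      Nat.factorial_succ (N + 1), Nat.factorial_succ N]
    push_cast
    have hk' : (N : ℝ) = k - 1 := by rw [hk]; push_cast; ring
    rw [hk']
    field_simp
    ring
  have hg0 : ∀ s ∈ Set.Ioi (0 : ℝ), 0 ≤ g s := fun s hs => by
    have : (0 : ℝ) < s := hs
    positivity
  refine ENNReal.toReal_le_of_le_ofReal (by positivity) ?_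
  rw [gammaMeasure_nat_apply N hC, ← hval, ofReal_integral_eq_lintegral_ofReal hint
    ((ae_restrict_mem measurableSet_Ioi).mono hg0)]
  refine setLIntegral_mono' measurableSet_Ioi fun s hs => ?_
  have hs' : (0 : ℝ) < s := hs
  by_cases h : s ∈ {s : ℝ | η * k ≤ |s - k|}
  · rw [Set.indicator_of_mem h]
    refine ENNReal.ofReal_le_ofReal ?_
    rw [hg]
    refine le_mul_of_one_le_left (by positivity) ?_
    rw [one_le_div (by positivity), ← sq_abs (s - k)]
    exact pow_le_pow_left₀ (by positivity) h 2
  · simp [h]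

/-- The tail `e^(-y) ∑_{j ≤ N} y^j / j!` of the gamma distribution with shape `N + 1`. -/
def gammaTail (N : ℕ) (y : ℝ) : ℝ :=
  Real.exp (-y) * ∑ j ∈ Finset.range (N + 1), y ^ j / j.factorial

theorem hasDerivAt_gammaTail (N : ℕ) (y : ℝ) :
    HasDerivAt (gammaTail N) (-(Real.exp (-y) * y ^ N / N.factorial)) y := by
  have hs : HasDerivAt (fun y : ℝ => ∑ j ∈ Finset.range (N + 1), y ^ j / j.factorial)
      (∑ j ∈ Finset.range N, y ^ j / j.factorial) y := by
    induction N with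
    | zero => simpa using hasDerivAt_const y (1 : ℝ)
    | succ N ih =>
      have h1 : HasDerivAt (fun y : ℝ => y ^ (N + 1) / (N + 1).factorial)
          (y ^ N / N.factorial) y := by
        refine ((hasDerivAt_pow (N + 1) y).div_const ((N + 1).factorial : ℝ)).congr_deriv ?_
        rw [Nat.factorial_succ]
        push_cast
        have : (0 : ℝ) < N.factorial := by positivity
        field_simp
      simp only [Finset.sum_range_succ _ (N + 1)]
      rw [Finset.sum_range_succ]
      exact ih.add h1
  have he : HasDerivAt (fun y : ℝ => Real.exp (-y)) (-Real.exp (-y)) y := by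
    simpa using (hasDerivAt_neg y).exp
  refine (he.mul hs).congr_deriv ?_
  rw [Finset.sum_range_succ]
  ring

theorem tendsto_gammaTail_atTop (N : ℕ) : Tendsto (gammaTail N) atTop (𝓝 0) := by
  have : Tendsto (fun y : ℝ => ∑ j ∈ Finset.range (N + 1),
      (y ^ j * Real.exp (-y)) / j.factorial) atTop (𝓝 (∑ j ∈ Finset.range (N + 1),
        (0 : ℝ) / j.factorial)) :=
    tendsto_finsetSum _ fun j _ =>
      (Real.tendsto_pow_mul_exp_neg_atTop_nhds_zero j).div_const _
  simp only [zero_div, Finset.sum_const_zero] at this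
  refine this.congr fun y => ?_
  rw [gammaTail, Finset.mul_sum]
  exact Finset.sum_congr rfl fun j _ => by ring

theorem gammaMeasure_Ici (N : ℕ) {y : ℝ} (hy : 0 ≤ y) :
    gammaMeasure ((N + 1 : ℕ) : ℝ) 1 (Set.Ici y) = ENNReal.ofReal (gammaTail N y) := by
  have hd : ∀ x ∈ Set.Ici y, HasDerivAt (fun x => -gammaTail N x)
      (Real.exp (-x) * x ^ N / N.factorial) x := fun x _ =>
    (hasDerivAt_gammaTail N x).fun_neg.congr_deriv (neg_neg _)
  have hpos : ∀ x ∈ Set.Ioi y, 0 ≤ Real.exp (-x) * x ^ N / N.factorial := fun x hx => by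
    have : 0 ≤ x := hy.trans (le_of_lt hx)
    positivity
  have ht : Tendsto (fun x => -gammaTail N x) atTop (𝓝 0) := by
    simpa using (tendsto_gammaTail_atTop N).neg
  have hint := integrableOn_Ioi_deriv_of_nonneg' hd hpos ht
  have hval := integral_Ioi_of_hasDerivAt_of_nonneg' hd hpos ht
  have hval' : gammaTail N y = ∫ x in Set.Ioi y, Real.exp (-x) * x ^ N / N.factorial := by
    rw [hval]
    ring
  rw [gammaMeasure_nat_apply N measurableSet_Ici, hval',
    ofReal_integral_eq_lintegral_ofReal hint ((ae_restrict_mem measurableSet_Ioi).mono hpos),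
    ← lintegral_indicator measurableSet_Ioi, ← lintegral_indicator measurableSet_Ioi]
  refine lintegral_congr_ae ?_
  filter_upwards [Measure.ae_ne (volume : Measure ℝ) y] with s hs
  by_cases h : y < s
  · rw [Set.indicator_of_mem (show s ∈ Set.Ioi 0 from hy.trans_lt h),
      Set.indicator_of_mem (show s ∈ Set.Ici y from h.le),
      Set.indicator_of_mem (show s ∈ Set.Ioi y from h)]
  · rw [Set.indicator_of_notMem (show s ∉ Set.Ioi y from h)]
    have h2 : s ∉ Set.Ici y := fun h3 => h (lt_of_le_of_ne h3 hs.symm)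
    by_cases h0 : s ∈ Set.Ioi (0 : ℝ)
    · rw [Set.indicator_of_mem h0, Set.indicator_of_notMem h2]
    · rw [Set.indicator_of_notMem h0]

instance isProbabilityMeasure_gammaMeasure_nat (N : ℕ) :
    IsProbabilityMeasure (gammaMeasure ((N + 1 : ℕ) : ℝ) 1) :=
  isProbabilityMeasure_gammaMeasure (by positivity) one_pos

theorem gammaTail_nonneg (N : ℕ) {y : ℝ} (hy : 0 ≤ y) : 0 ≤ gammaTail N y :=
  mul_nonneg (Real.exp_nonneg _) (Finset.sum_nonneg fun j _ => by positivity)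

theorem gammaMeasure_real_Ici (N : ℕ) {y : ℝ} (hy : 0 ≤ y) :
    (gammaMeasure ((N + 1 : ℕ) : ℝ) 1).real (Set.Ici y) = gammaTail N y := by
  rw [Measure.real, gammaMeasure_Ici N hy, ENNReal.toReal_ofReal (gammaTail_nonneg N hy)]

theorem gammaMeasure_real_Iio (N : ℕ) {y : ℝ} (hy : 0 ≤ y) :
    (gammaMeasure ((N + 1 : ℕ) : ℝ) 1).real (Set.Iio y) = 1 - gammaTail N y := by
  rw [← gammaMeasure_real_Ici N hy, ← Set.compl_Ici, probReal_compl_eq_one_sub measurableSet_Ici]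


/-! ### Independent exponential variables and the simplex -/

instance isProbabilityMeasure_expMeasure_one : IsProbabilityMeasure (expMeasure 1) :=
  isProbabilityMeasure_expMeasure one_pos

theorem lintegral_fin_prod {n : ℕ} (f : Fin n → ℝ → ENNReal) (hf : ∀ i, Measurable (f i)) :
    ∫⁻ x : Fin n → ℝ, ∏ i, f i (x i) = ∏ i, ∫⁻ t, f i t := by
  induction n with
  | zero => simp [volume_pi]
  | succ n ih =>
    rw [← (volume_preserving_piFinSuccAbove (fun _ : Fin (n + 1) => ℝ) 0).symm.lintegral_comp_emb
      (MeasurableEquiv.measurableEmbedding _)]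
    simp only [Fin.prod_univ_succ]
    rw [← ih (fun i => f i.succ) fun i => hf _]
    rw [← lintegral_prod_mul (g := fun x : Fin n → ℝ => ∏ i, f i.succ (x i)) (hf 0).aemeasurable
      (Finset.measurable_prod _ fun i _ => (hf i.succ).comp (measurable_pi_apply i)).aemeasurable]
    rfl

/-- The joint density of independent exponential variables only depends on their sum. -/
theorem pi_expMeasure_apply {n : ℕ} {S : Set (Fin n → ℝ)} (hS : MeasurableSet S) :
    Measure.pi (fun _ : Fin n => expMeasure 1) S =
      ∫⁻ x, (S ∩ {x | ∀ i, 0 ≤ x i}).indicator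
        (fun x => ENNReal.ofReal (Real.exp (-∑ i, x i))) x := by
  have hm : Measurable (exponentialPDF 1) := (measurable_exponentialPDFReal 1).ennreal_ofReal
  have hpi : Measure.pi (fun _ : Fin n => expMeasure 1) =
      (volume : Measure (Fin n → ℝ)).withDensity fun x => ∏ i, exponentialPDF 1 (x i) := by
    refine Measure.pi_eq fun s hs => ?_
    rw [withDensity_apply _ (MeasurableSet.univ_pi hs),
      ← lintegral_indicator (MeasurableSet.univ_pi hs)]
    simp only [expMeasure, gammaMeasure]
    have : ∀ x : Fin n → ℝ, (Set.univ.pi s).indicator (fun x => ∏ i, exponentialPDF 1 (x i)) x =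
        ∏ i, (s i).indicator (exponentialPDF 1) (x i) := by
      intro x
      by_cases h : x ∈ Set.univ.pi s
      · rw [Set.indicator_of_mem h]
        exact Finset.prod_congr rfl fun i _ => (Set.indicator_of_mem (h i trivial) _).symm
      · rw [Set.indicator_of_notMem h]
        simp only [Set.mem_univ_pi, not_forall] at h
        obtain ⟨i, hi⟩ := h
        exact (Finset.prod_eq_zero (Finset.mem_univ i) (Set.indicator_of_notMem hi _)).symm
    simp only [this]
    rw [lintegral_fin_prod _ fun i => hm.indicator (hs i)]
    refine Finset.prod_congr rfl fun i _ => ?_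
    rw [lintegral_indicator (hs i), withDensity_apply _ (hs i)]
    rfl
  rw [hpi, withDensity_apply _ hS, ← lintegral_indicator hS]
  refine lintegral_congr fun x => ?_
  by_cases h : x ∈ S
  · by_cases h0 : ∀ i, 0 ≤ x i
    · rw [Set.indicator_of_mem h,
        Set.indicator_of_mem (show x ∈ S ∩ {x | ∀ i, 0 ≤ x i} from ⟨h, h0⟩),
        ← Finset.sum_neg_distrib, Real.exp_sum,
        ENNReal.ofReal_prod_of_nonneg fun i _ => Real.exp_nonneg _]
      refine Finset.prod_congr rfl fun i _ => ?_
      rw [exponentialPDF_of_nonneg (h0 i)]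
      simp
    · rw [Set.indicator_of_mem h, Set.indicator_of_notMem fun h' => h0 h'.2]
      push Not at h0
      obtain ⟨i, hi⟩ := h0
      exact Finset.prod_eq_zero (Finset.mem_univ i) (exponentialPDF_of_neg hi)
  · rw [Set.indicator_of_notMem h, Set.indicator_of_notMem fun h' => h h'.1]

/-- The linear map that replaces the last coordinate by the sum of all coordinates. -/
def sumLast (N : ℕ) : (Fin (N + 1) → ℝ) →ₗ[ℝ] (Fin (N + 1) → ℝ) where
  toFun x := Fin.snoc (α := fun _ => ℝ) (fun i : Fin N => x i.castSucc) (∑ i, x i)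
  map_add' x y := by
    ext i
    refine Fin.lastCases ?_ (fun i => ?_) i <;> simp [Finset.sum_add_distrib]
  map_smul' c x := by
    ext i
    refine Fin.lastCases ?_ (fun i => ?_) i <;> simp [Finset.mul_sum]

theorem sumLast_castSucc {N : ℕ} (x : Fin (N + 1) → ℝ) (i : Fin N) :
    sumLast N x i.castSucc = x i.castSucc := by
  simp [sumLast]

theorem sumLast_last {N : ℕ} (x : Fin (N + 1) → ℝ) :
    sumLast N x (Fin.last N) = ∑ i, x i := by
  simp [sumLast]

theorem sumLast_injective (N : ℕ) : Function.Injective (sumLast N) := by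
  intro x y h
  have h1 (i : Fin N) : x i.castSucc = y i.castSucc := by
    rw [← sumLast_castSucc x, h, sumLast_castSucc]
  have h2 : ∑ i, x i = ∑ i, y i := by rw [← sumLast_last x, h, sumLast_last]
  ext i
  refine Fin.lastCases ?_ h1 i
  rw [Fin.sum_univ_castSucc, Fin.sum_univ_castSucc] at h2
  simpa [h1] using h2

/-- Integrals of functions of the sum and of the first `N` coordinates are iterated integrals, up
to a constant factor. -/
theorem lintegral_sum_castSucc (N : ℕ) : ∃ c : ENNReal, ∀ g : ℝ × (Fin N → ℝ) → ENNReal,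
    Measurable g → ∫⁻ x : Fin (N + 1) → ℝ, g (∑ i, x i, fun i => x i.castSucc) =
      c * ∫⁻ s, ∫⁻ w, g (s, w) := by
  obtain ⟨c, hc⟩ := volume_preimage_injective_linearMap _ (sumLast_injective N)
  have hm : Measurable (sumLast N) :=
    (LinearMap.continuous_of_finiteDimensional (sumLast N)).measurable
  have hmap : Measure.map (sumLast N) volume = c • volume := by
    ext s hs
    rw [Measure.map_apply hm hs, hc]
    simp
  refine ⟨c, fun g hg => ?_⟩
  have e := volume_preserving_piFinSuccAbove (fun _ : Fin (N + 1) => ℝ) (Fin.last N)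
  have h1 : ∫⁻ x : Fin (N + 1) → ℝ, g (∑ i, x i, fun i => x i.castSucc) =
      ∫⁻ y, g (MeasurableEquiv.piFinSuccAbove (fun _ : Fin (N + 1) => ℝ) (Fin.last N) y)
        ∂(Measure.map (sumLast N) volume) := by
    rw [lintegral_map (f := fun y => g (MeasurableEquiv.piFinSuccAbove
      (fun _ : Fin (N + 1) => ℝ) (Fin.last N) y)) (hg.comp (MeasurableEquiv.measurable _)) hm]
    refine lintegral_congr fun x => ?_
    congr 1
    refine Prod.ext (sumLast_last x).symm (funext fun i => ?_)
    change _ = sumLast N x ((Fin.last N).succAbove i)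
    rw [Fin.succAbove_last, sumLast_castSucc]
  rw [h1, hmap, lintegral_smul_measure, e.lintegral_comp hg, smul_eq_mul]
  congr 1
  exact lintegral_prod _ hg.aemeasurable

theorem volume_cornerSimplex_lt_top (N : ℕ) : volume (cornerSimplex N) < ⊤ := by
  refine (measure_mono (t := Set.univ.pi fun _ => Set.Icc (0 : ℝ) 1) fun v hv i _ =>
    ⟨hv.1 i, (Finset.single_le_sum (fun j _ => hv.1 j) (Finset.mem_univ i)).trans hv.2⟩).trans_lt ?_
  rw [volume_pi_pi]
  simp

/-- For independent exponential variables `x₀, …, x_N` with sum `S`, the vector of the first `N`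
ratios `xᵢ / S` is uniform on the corner simplex, `S` has the gamma distribution, and the two are
independent. -/
theorem pi_expMeasure_ratio_sum (N : ℕ) {B : Set (Fin N → ℝ)} (hB : MeasurableSet B)
    {C : Set ℝ} (hC : MeasurableSet C) :
    Measure.pi (fun _ : Fin (N + 1) => expMeasure 1)
        {x | (∑ i, x i)⁻¹ • (fun i : Fin N => x i.castSucc) ∈ B ∧ ∑ i, x i ∈ C} =
      ProbabilityTheory.cond volume (cornerSimplex N) B * gammaMeasure ((N + 1 : ℕ) : ℝ) 1 C := by
  -- `c` is the Jacobian constant, left uncomputed, of `x ↦ (∑ x, x₀, …, x_{N-1})`. For a fixed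
  -- sum `s` the first `N` coordinates range over `s • cornerSimplex N`, which contributes `s ^ N`.
  -- Taking `B` and `C` to be everything identifies `c * N! * volume (cornerSimplex N)` as `1`.
  obtain ⟨c, hc⟩ := lintegral_sum_castSucc N
  have key : ∀ B : Set (Fin N → ℝ), MeasurableSet B → ∀ C : Set ℝ, MeasurableSet C →
      Measure.pi (fun _ : Fin (N + 1) => expMeasure 1)
        {x | (∑ i, x i)⁻¹ • (fun i : Fin N => x i.castSucc) ∈ B ∧ ∑ i, x i ∈ C} =
      c * N.factorial * volume (cornerSimplex N ∩ B) * gammaMeasure ((N + 1 : ℕ) : ℝ) 1 C := by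
    intro B hB C hC
    have hS : Measurable fun x : Fin (N + 1) → ℝ => ∑ i, x i := by fun_prop
    have hset : MeasurableSet
        {x : Fin (N + 1) → ℝ | (∑ i, x i)⁻¹ • (fun i : Fin N => x i.castSucc) ∈ B ∧
          ∑ i, x i ∈ C} := by
      refine MeasurableSet.inter ?_ (hS hC)
      have : Measurable fun x : Fin (N + 1) → ℝ =>
          (∑ i, x i)⁻¹ • (fun i : Fin N => x i.castSucc) :=
        hS.inv.smul (measurable_pi_iff.2 fun i => measurable_pi_apply _)
      exact this hB
    set G : Set (ℝ × (Fin N → ℝ)) :=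
      {p | (p.1⁻¹ • p.2 ∈ B ∧ p.1 ∈ C) ∧ (∀ i, 0 ≤ p.2 i) ∧ ∑ i, p.2 i ≤ p.1} with hG
    have hGm : MeasurableSet G := by
      refine MeasurableSet.inter (MeasurableSet.inter ?_ (measurable_fst hC))
        (MeasurableSet.inter ?_ ?_)
      · exact (measurable_fst.inv.smul measurable_snd) hB
      · exact measurableSet_forall fun i =>
          measurableSet_le measurable_const ((measurable_pi_apply i).comp measurable_snd)
      · exact measurableSet_le
          (Finset.measurable_sum _ fun i _ => (measurable_pi_apply i).comp measurable_snd)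
          measurable_fst
    have hgm : Measurable
        (G.indicator fun p : ℝ × (Fin N → ℝ) => ENNReal.ofReal (Real.exp (-p.1))) :=
      (by fun_prop : Measurable fun p : ℝ × (Fin N → ℝ) =>
        ENNReal.ofReal (Real.exp (-p.1))).indicator hGm
    have h1 : Measure.pi (fun _ : Fin (N + 1) => expMeasure 1)
        {x | (∑ i, x i)⁻¹ • (fun i : Fin N => x i.castSucc) ∈ B ∧ ∑ i, x i ∈ C} =
        ∫⁻ x : Fin (N + 1) → ℝ,
          G.indicator (fun p : ℝ × (Fin N → ℝ) => ENNReal.ofReal (Real.exp (-p.1)))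
            (∑ i, x i, fun i => x i.castSucc) := by
      rw [pi_expMeasure_apply hset]
      refine lintegral_congr fun x => ?_
      have hiff : (∀ i, 0 ≤ x i) ↔ (∀ i : Fin N, 0 ≤ x i.castSucc) ∧
          ∑ i : Fin N, x i.castSucc ≤ ∑ i, x i := by
        rw [Fin.forall_fin_succ', Fin.sum_univ_castSucc]
        simp
      classical
      simp only [Set.indicator_apply]
      exact if_congr (and_congr_right' hiff) rfl rfl
    have hV : volume (cornerSimplex N ∩ B) ≠ ⊤ :=
      ((measure_mono Set.inter_subset_left).trans_lt (volume_cornerSimplex_lt_top N)).ne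
    rw [h1, hc _ hgm, mul_assoc, mul_assoc, gammaMeasure_nat_apply N hC,
      ← lintegral_const_mul' _ _ hV, ← lintegral_const_mul' _ _ (ENNReal.natCast_ne_top _),
      ← lintegral_indicator measurableSet_Ioi]
    congr 1
    refine lintegral_congr_ae ?_
    filter_upwards [Measure.ae_ne (volume : Measure ℝ) 0] with s hs
    by_cases h0 : 0 < s
    · rw [Set.indicator_of_mem (show s ∈ Set.Ioi 0 from h0)]
      by_cases hsC : s ∈ C
      · have hset' : MeasurableSet ((s⁻¹ • ·) ⁻¹' (cornerSimplex N ∩ B) : Set (Fin N → ℝ)) :=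
          (measurable_const_smul s⁻¹) ((measurableSet_cornerSimplex N).inter hB)
        have hin : ∀ w : Fin N → ℝ,
            G.indicator (fun p : ℝ × (Fin N → ℝ) => ENNReal.ofReal (Real.exp (-p.1))) (s, w) =
              ((s⁻¹ • ·) ⁻¹' (cornerSimplex N ∩ B)).indicator
                (fun _ => ENNReal.ofReal (Real.exp (-s))) w := by
          intro w
          classical
          simp only [Set.indicator_apply]
          refine if_congr ?_ rfl rfl
          have hsi : 0 < s⁻¹ := inv_pos.2 h0
          simp only [hG, Set.mem_ofPred_eq, Set.mem_preimage, Set.mem_inter_iff, cornerSimplex,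
            Pi.smul_apply, smul_eq_mul, hsC, and_true, ← Finset.mul_sum,
            mul_nonneg_iff_of_pos_left hsi, inv_mul_le_one₀ h0]
          tauto
        simp only [hin]
        rw [lintegral_indicator_const hset', Measure.addHaar_preimage_smul _ (inv_ne_zero h0.ne'),
          Set.indicator_of_mem hsC, Module.finrank_fin_fun, inv_pow, inv_inv,
          abs_of_nonneg (by positivity), mul_left_comm _ (volume _), mul_comm (volume _),
          ← mul_assoc, ← ENNReal.ofReal_natCast, ← ENNReal.ofReal_mul (by positivity),
          ← ENNReal.ofReal_mul (by positivity)]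
        congr 2
        field_simp
      · rw [Set.indicator_of_notMem hsC, mul_zero, mul_zero]
        refine lintegral_eq_zero_of_ae_eq_zero (Eventually.of_forall fun w => ?_)
        exact Set.indicator_of_notMem (fun h => hsC h.1.2) _
    · rw [Set.indicator_of_notMem (show s ∉ Set.Ioi 0 from h0)]
      refine lintegral_eq_zero_of_ae_eq_zero (Eventually.of_forall fun w => ?_)
      refine Set.indicator_of_notMem (fun h => ?_) _
      have h2 : ∑ i, w i ≤ s := h.2.2
      exact h0 (lt_of_le_of_ne ((Finset.sum_nonneg fun i _ => h.2.1 i).trans h2) hs.symm)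
  have h1 := key Set.univ MeasurableSet.univ Set.univ MeasurableSet.univ
  have := isProbabilityMeasure_gammaMeasure_nat N
  simp only [Set.mem_univ, and_self, Set.inter_univ, measure_univ, mul_one] at h1
  rw [key B hB C hC, ProbabilityTheory.cond_apply (measurableSet_cornerSimplex N)]
  congr 2
  refine ENNReal.eq_inv_of_mul_eq_one_left ?_
  rw [← h1]
  simp


/-! ### Windows of spacings and windows of exponential variables -/

/-- The sum of `m` consecutive terms of a sequence, starting with the term numbered `i`. -/
def window (m : ℕ) (d : ℕ → ℝ) (i : ℕ) : ℝ := ∑ j ∈ Finset.range m, d (i + j)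

/-- The law of a sequence of independent standard exponential variables. -/
def expSeq : Measure (ℕ → ℝ) := Measure.infinitePi fun _ => expMeasure 1

instance : IsProbabilityMeasure expSeq := by
  unfold expSeq
  infer_instance

/-- The law of `N` independent points, uniform on `[0, 1]`. -/
abbrev uniformCube (N : ℕ) : Measure (Fin N → ℝ) :=
  volume.restrict (Set.univ.pi fun _ : Fin N => Set.Icc (0 : ℝ) 1)

theorem measurable_window (m i : ℕ) : Measurable fun d : ℕ → ℝ => window m d i :=
  Finset.measurable_sum _ fun _ _ => measurable_pi_apply _

theorem map_expSeq {n : ℕ} {f : Fin n → ℕ} (hf : Function.Injective f) :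
    Measure.map (fun e j => e (f j)) expSeq = Measure.pi fun _ => expMeasure 1 := by
  rw [expSeq, Measure.map_infinitePi_infinitePi_of_inj (P := fun _ : ℕ => expMeasure 1) hf,
    Measure.infinitePi_eq_pi]

theorem pi_expMeasure_sum (N : ℕ) {C : Set ℝ} (hC : MeasurableSet C) :
    Measure.pi (fun _ : Fin (N + 1) => expMeasure 1) {x | ∑ i, x i ∈ C} =
      gammaMeasure ((N + 1 : ℕ) : ℝ) 1 C := by
  have := pi_expMeasure_ratio_sum N MeasurableSet.univ hC
  have hp : IsProbabilityMeasure (ProbabilityTheory.cond volume (cornerSimplex N)) := by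
    rw [← map_spacing_eq_cond]
    exact Measure.isProbabilityMeasure_map
      (measurable_pi_iff.2 fun i : Fin N => measurable_spacing (i : ℕ)).aemeasurable
  simpa using this

theorem expSeq_window (N i : ℕ) {C : Set ℝ} (hC : MeasurableSet C) :
    expSeq {e | window (N + 1) e i ∈ C} = gammaMeasure ((N + 1 : ℕ) : ℝ) 1 C := by
  rw [← pi_expMeasure_sum N hC, ← map_expSeq (f := fun j : Fin (N + 1) => i + j)
    (fun a b h => Fin.ext (Nat.add_left_cancel h)), Measure.map_apply]
  · simp only [window, Finset.sum_range]
    rfl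
  · exact measurable_pi_iff.2 fun j => measurable_pi_apply _
  · exact (by fun_prop : Measurable fun x : Fin (N + 1) → ℝ => ∑ i, x i) hC

theorem ae_expSeq_nonneg : ∀ᵐ e ∂expSeq, ∀ i, 0 ≤ e i := by
  refine ae_all_iff.2 fun i => ?_
  have h := expSeq_window 0 i (measurableSet_Iio (a := (0 : ℝ)))
  rw [gammaMeasure_nat_apply 0 measurableSet_Iio] at h
  rw [ae_iff]
  have h0 : ∫⁻ s in Set.Ioi (0 : ℝ), (Set.Iio 0).indicator
      (fun s => ENNReal.ofReal (Real.exp (-s) * s ^ 0 / (Nat.factorial 0))) s = 0 := by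
    rw [← lintegral_indicator measurableSet_Ioi]
    refine lintegral_eq_zero_of_ae_eq_zero (Eventually.of_forall fun s => ?_)
    by_cases hs : 0 < s
    · rw [Set.indicator_of_mem (show s ∈ Set.Ioi 0 from hs),
        Set.indicator_of_notMem (show s ∉ Set.Iio 0 from not_lt.2 hs.le)]
      rfl
    · exact Set.indicator_of_notMem hs _
  rw [h0] at h
  simpa [window] using h

/-- Aligned windows are independent. -/
theorem expSeq_blocks (N n : ℕ) (t : ℝ) :
    expSeq.real {e | ∀ s < n, window (N + 1) e (s * (N + 1)) < t} =
      (gammaMeasure ((N + 1 : ℕ) : ℝ) 1).real (Set.Iio t) ^ n := by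
  have hinj : Function.Injective fun p : ℕ × Fin (N + 1) => p.1 * (N + 1) + (p.2 : ℕ) := by
    rintro ⟨a, i⟩ ⟨b, j⟩ h
    have h' : a * (N + 1) + (i : ℕ) = b * (N + 1) + (j : ℕ) := h
    have h1 : a = b := by
      have := congrArg (· / (N + 1)) h'
      simpa [Nat.add_div_of_dvd_right, Nat.div_eq_of_lt i.2, Nat.div_eq_of_lt j.2] using this
    subst h1
    exact Prod.ext rfl (Fin.ext (Nat.add_left_cancel h'))
  have hmap : Measure.map (fun (e : ℕ → ℝ) (s : ℕ) (j : Fin (N + 1)) => e (s * (N + 1) + j))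
      expSeq = Measure.infinitePi fun _ : ℕ => Measure.infinitePi fun _ : Fin (N + 1) =>
        expMeasure 1 := by
    have h1 := Measure.map_infinitePi_infinitePi_of_inj (P := fun _ : ℕ => expMeasure 1) hinj
    have h2 := Measure.infinitePi_map_curry (ι := ℕ) (κ := Fin (N + 1))
      (fun _ _ => expMeasure 1)
    rw [← h2, ← h1, Measure.map_map (by fun_prop) (by fun_prop)]
    rfl
  set T : Set (Fin (N + 1) → ℝ) := {x | ∑ i, x i ∈ Set.Iio t} with hT
  have hTm : MeasurableSet T :=
    (by fun_prop : Measurable fun x : Fin (N + 1) → ℝ => ∑ i, x i) measurableSet_Iio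
  have hset : {e : ℕ → ℝ | ∀ s < n, window (N + 1) e (s * (N + 1)) < t} =
      (fun (e : ℕ → ℝ) (s : ℕ) (j : Fin (N + 1)) => e (s * (N + 1) + j)) ⁻¹'
        Set.pi (Finset.range n) fun _ => T := by
    ext e
    simp [hT, window, Set.mem_pi, Finset.sum_range]
  rw [Measure.real, hset, ← Measure.map_apply (by fun_prop)
    (MeasurableSet.pi (Finset.range n).countable_toSet fun _ _ => hTm), hmap,
    Measure.infinitePi_pi _ fun _ _ => hTm, Finset.prod_const, Finset.card_range,
    Measure.infinitePi_eq_pi, pi_expMeasure_sum N measurableSet_Iio, ENNReal.toReal_pow]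
  rfl

/-- The sequence that agrees with `d` below `k` and vanishes from `k` on. -/
def truncate (k : ℕ) (d : ℕ → ℝ) : ℕ → ℝ := fun i => if i < k then d i else 0

theorem spacing_eq_zero {N : ℕ} (u : Fin N → ℝ) {i : ℕ} (hi : N < i) : spacing u i = 0 := by
  have h1 : ¬ i < N := by omega
  have h2 : ¬ i - 1 < N := by omega
  have h3 : i ≠ 0 := by omega
  simp [spacing, orderStat, h1, h2, h3]

/-- The spacings of independent uniform points are distributed like independent exponential
variables divided by their sum, and the sum is independent of these ratios. -/
theorem uniformCube_spacing_mul_gamma (N : ℕ) {H : Set (Fin (N + 1) → ℝ)} (hH : MeasurableSet H)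
    {C : Set ℝ} (hC : MeasurableSet C) (h0 : (0 : ℝ) ∉ C) :
    uniformCube N {u | (fun i : Fin (N + 1) => spacing u i) ∈ H} *
        gammaMeasure ((N + 1 : ℕ) : ℝ) 1 C =
      expSeq {e | (window (N + 1) e 0)⁻¹ • (fun i : Fin (N + 1) => e i) ∈ H ∧
        window (N + 1) e 0 ∈ C} := by
  have h1 : uniformCube N {u | (fun i : Fin (N + 1) => spacing u i) ∈ H} =
      ProbabilityTheory.cond volume (cornerSimplex N) (simplexLift ⁻¹' H) := by
    rw [← map_spacing_eq_cond, Measure.map_apply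
      (measurable_pi_iff.2 fun i : Fin N => measurable_spacing (i : ℕ)) (measurable_simplexLift hH)]
    congr 1
    ext u
    simp only [Set.mem_ofPred_eq, Set.mem_preimage]
    rw [show (fun i : Fin (N + 1) => spacing u i) = simplexLift (fun j : Fin N => spacing u j) from
      funext fun i => spacing_eq_simplexLift u i]
  have hsum : Measurable fun x : Fin (N + 1) → ℝ => ∑ i, x i := by fun_prop
  rw [h1, ← pi_expMeasure_ratio_sum N (measurable_simplexLift hH) hC,
    ← map_expSeq (f := fun j : Fin (N + 1) => (j : ℕ)) Fin.val_injective, Measure.map_apply]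
  · congr 1
    ext e
    simp only [Set.mem_preimage, Set.mem_ofPred_eq, window, zero_add]
    rw [Finset.sum_range (fun j => e j)]
    refine and_congr_left fun hS => ?_
    have hne : ∑ i : Fin (N + 1), e i ≠ 0 := fun h => h0 (h ▸ hS)
    have : simplexLift ((∑ i : Fin (N + 1), e i)⁻¹ • fun i : Fin N => e (i.castSucc : Fin (N + 1)))
        = (∑ i : Fin (N + 1), e i)⁻¹ • fun i : Fin (N + 1) => e i := by
      ext i
      refine Fin.lastCases ?_ (fun i => ?_) i
      · rw [simplexLift_last]
        simp only [Pi.smul_apply, smul_eq_mul, ← Finset.mul_sum]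
        rw [eq_comm, inv_mul_eq_iff_eq_mul₀ hne, mul_sub, mul_inv_cancel_left₀ hne, mul_one,
          Fin.sum_univ_castSucc]
        ring
      · rw [simplexLift_castSucc]
        rfl
    rw [this]
  · exact measurable_pi_iff.2 fun j => measurable_pi_apply _
  · refine MeasurableSet.inter ?_ (hsum hC)
    have : Measurable fun x : Fin (N + 1) → ℝ =>
        (∑ i, x i)⁻¹ • (fun i : Fin N => x i.castSucc) :=
      hsum.inv.smul (measurable_pi_iff.2 fun i => measurable_pi_apply _)
    exact this (measurable_simplexLift hH)

/-- The event that all windows starting in `I` are shorter than `t`. -/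
def windowsLt (m : ℕ) (I : Finset ℕ) (t : ℝ) : Set (ℕ → ℝ) := {d | ∀ i ∈ I, window m d i < t}

theorem measurableSet_windowsLt (m : ℕ) (I : Finset ℕ) (t : ℝ) :
    MeasurableSet (windowsLt m I t) := by
  refine measurableSet_forall fun i => ?_
  by_cases h : i ∈ I
  · simpa [h] using measurableSet_lt (measurable_window m i) measurable_const
  · simp [h]

theorem measurable_truncate (k : ℕ) : Measurable (truncate k) := by
  refine measurable_pi_iff.2 fun i => ?_
  by_cases h : i < k
  · simpa [truncate, h] using measurable_pi_apply i
  · simp [truncate, h]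

theorem window_smul (m : ℕ) (c : ℝ) (d : ℕ → ℝ) (i : ℕ) :
    window m (c • d) i = c * window m d i := by
  simp [window, Finset.mul_sum]

/-- The independence of the spacings and the sum, for the event that given windows are shorter than
`t`. In terms of exponential variables this says that they are shorter than `t` times the sum, which
is the window of length `N + 1` at `0`. -/
theorem uniformCube_windowsLt_mul_gamma (m N : ℕ) (I : Finset ℕ) (t : ℝ)
    {C : Set ℝ} (hC : MeasurableSet C) (h0 : C ⊆ Set.Ioi 0) :
    (uniformCube N).real {u | spacing u ∈ windowsLt m I t} *
        (gammaMeasure ((N + 1 : ℕ) : ℝ) 1).real C =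
      expSeq.real {e | truncate (N + 1) e ∈ windowsLt m I (t * window (N + 1) e 0) ∧
        window (N + 1) e 0 ∈ C} := by
  let ext : (Fin (N + 1) → ℝ) → ℕ → ℝ := fun x i => if h : i < N + 1 then x ⟨i, h⟩ else 0
  have hext : Measurable ext := by
    refine measurable_pi_iff.2 fun i => ?_
    simp only [ext]
    split_ifs with h
    · exact measurable_pi_apply _
    · exact measurable_const
  have hH : MeasurableSet (ext ⁻¹' windowsLt m I t) := hext (measurableSet_windowsLt m I t)
  have h := uniformCube_spacing_mul_gamma N hH hC fun h => lt_irrefl (0 : ℝ) (h0 h)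
  have h' := congrArg ENNReal.toReal h
  rw [ENNReal.toReal_mul] at h'
  have hs (u : Fin N → ℝ) : ext (fun i : Fin (N + 1) => spacing u i) = spacing u := by
    ext i
    by_cases h : i < N + 1
    · simp only [ext, dif_pos h]
    · simp only [ext, dif_neg h, spacing_eq_zero u (by omega : N < i)]
  have he (e : ℕ → ℝ) (c : ℝ) : ext (c • fun i : Fin (N + 1) => e i) = c • truncate (N + 1) e := by
    ext i
    by_cases h : i < N + 1
    · simp only [ext, truncate, Pi.smul_apply, dif_pos h, if_pos h]
    · simp only [ext, truncate, Pi.smul_apply, dif_neg h, if_neg h, smul_zero]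
  have hset1 : {u : Fin N → ℝ | (fun i : Fin (N + 1) => spacing u i) ∈ ext ⁻¹' windowsLt m I t} =
      {u | spacing u ∈ windowsLt m I t} := by
    ext u
    simp only [Set.mem_ofPred_eq, Set.mem_preimage, hs]
  have hset2 : {e : ℕ → ℝ | (window (N + 1) e 0)⁻¹ • (fun i : Fin (N + 1) => e i) ∈
        ext ⁻¹' windowsLt m I t ∧ window (N + 1) e 0 ∈ C} =
      {e | truncate (N + 1) e ∈ windowsLt m I (t * window (N + 1) e 0) ∧
        window (N + 1) e 0 ∈ C} := by
    ext e
    simp only [Set.mem_ofPred_eq, Set.mem_preimage, he]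
    refine and_congr_left fun hS => ?_
    have hpos : 0 < window (N + 1) e 0 := h0 hS
    refine forall₂_congr fun i _ => ?_
    rw [window_smul, inv_mul_lt_iff₀ hpos, mul_comm t]
  rw [hset1, hset2] at h'
  exact h'

/-- The values within a factor `1 ± η` of `k`. -/
def nearInterval (k : ℕ) (η : ℝ) : Set ℝ := Set.Ioo ((1 - η) * k) ((1 + η) * k)

theorem nearInterval_subset {k : ℕ} {η : ℝ} (hη : η ≤ 1) : nearInterval k η ⊆ Set.Ioi 0 :=
  fun _ h => (mul_nonneg (sub_nonneg.2 hη) (Nat.cast_nonneg k)).trans_lt h.1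

theorem gammaMeasure_compl_nearInterval_le (N : ℕ) {η : ℝ} (hη : 0 < η) :
    (gammaMeasure ((N + 1 : ℕ) : ℝ) 1).real (nearInterval (N + 1) η)ᶜ ≤
      1 / ((N + 1 : ℕ) * η ^ 2) := by
  refine (measureReal_mono fun s hs => ?_).trans (gammaMeasure_deviation_le N hη)
  simp only [Set.mem_ofPred_eq]
  by_contra h
  rw [not_le, abs_lt] at h
  exact hs ⟨by linarith [h.1], by linarith [h.2]⟩

theorem measurableSet_nearInterval (k : ℕ) (η : ℝ) : MeasurableSet (nearInterval k η) :=
  measurableSet_Ioo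

theorem windowsLt_mono {m : ℕ} {I : Finset ℕ} {t t' : ℝ} (h : t ≤ t') :
    windowsLt m I t ⊆ windowsLt m I t' := fun _ hd i hi => (hd i hi).trans_le h

/-- Replacing spacings by exponential variables, lower bound. -/
theorem le_uniformCube_windowsLt (m N : ℕ) (I : Finset ℕ) {t η : ℝ} (ht : 0 ≤ t)
    (hη : 0 < η) (hη1 : η ≤ 1) :
    expSeq.real {e | truncate (N + 1) e ∈ windowsLt m I (t * ((1 - η) * (N + 1 : ℕ)))} -
        1 / ((N + 1 : ℕ) * η ^ 2) ≤
      (uniformCube N).real {u | spacing u ∈ windowsLt m I t} := by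
  have h1 := uniformCube_windowsLt_mul_gamma m N I t (measurableSet_nearInterval (N + 1) η)
    (nearInterval_subset hη1)
  have h2 : expSeq.real {e | truncate (N + 1) e ∈ windowsLt m I (t * ((1 - η) * (N + 1 : ℕ)))} ≤
      expSeq.real {e | truncate (N + 1) e ∈ windowsLt m I (t * window (N + 1) e 0) ∧
        window (N + 1) e 0 ∈ nearInterval (N + 1) η} +
      expSeq.real {e | window (N + 1) e 0 ∈ (nearInterval (N + 1) η)ᶜ} := by
    refine (measureReal_mono fun e he => ?_).trans (measureReal_union_le _ _)
    by_cases h : window (N + 1) e 0 ∈ nearInterval (N + 1) η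
    · exact Or.inl ⟨windowsLt_mono (mul_le_mul_of_nonneg_left h.1.le ht) he, h⟩
    · exact Or.inr h
  have h3 : expSeq.real {e | window (N + 1) e 0 ∈ (nearInterval (N + 1) η)ᶜ} ≤
      1 / ((N + 1 : ℕ) * η ^ 2) := by
    rw [Measure.real, expSeq_window N 0 (measurableSet_nearInterval (N + 1) η).compl]
    exact gammaMeasure_compl_nearInterval_le N hη
  have h4 : (uniformCube N).real {u | spacing u ∈ windowsLt m I t} *
      (gammaMeasure ((N + 1 : ℕ) : ℝ) 1).real (nearInterval (N + 1) η) ≤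
      (uniformCube N).real {u | spacing u ∈ windowsLt m I t} :=
    mul_le_of_le_one_right measureReal_nonneg measureReal_le_one
  linarith

/-- Replacing spacings by exponential variables, upper bound. -/
theorem uniformCube_windowsLt_mul_le (m N : ℕ) (I : Finset ℕ) {t η : ℝ} (ht : 0 ≤ t)
    (hη : 0 < η) (hη1 : η ≤ 1) :
    (uniformCube N).real {u | spacing u ∈ windowsLt m I t} * (1 - 1 / ((N + 1 : ℕ) * η ^ 2)) ≤
      expSeq.real {e | truncate (N + 1) e ∈ windowsLt m I (t * ((1 + η) * (N + 1 : ℕ)))} := by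
  have h1 := uniformCube_windowsLt_mul_gamma m N I t (measurableSet_nearInterval (N + 1) η)
    (nearInterval_subset hη1)
  have h2 : 1 - 1 / ((N + 1 : ℕ) * η ^ 2) ≤
      (gammaMeasure ((N + 1 : ℕ) : ℝ) 1).real (nearInterval (N + 1) η) := by
    have := gammaMeasure_compl_nearInterval_le N hη
    rw [probReal_compl_eq_one_sub (measurableSet_nearInterval (N + 1) η)] at this
    linarith
  refine (mul_le_mul_of_nonneg_left h2 measureReal_nonneg).trans (h1.trans_le ?_)
  exact measureReal_mono fun e he => windowsLt_mono (mul_le_mul_of_nonneg_left he.2.2.le ht) he.1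


/-! ### Gumbel limits -/

theorem tendsto_log_natCast_atTop : Tendsto (fun n : ℕ => Real.log n) atTop atTop :=
  Real.tendsto_log_atTop.comp tendsto_natCast_atTop_atTop

theorem tendsto_centering_div_log (m : ℕ) :
    Tendsto (fun n : ℕ => centering m n / Real.log n) atTop (𝓝 0) := by
  have h1 : Tendsto (fun n : ℕ => Real.log (Real.log n) / Real.log n) atTop (𝓝 0) := by
    have := (Real.isLittleO_log_id_atTop.comp_tendsto tendsto_log_natCast_atTop)
    exact this.tendsto_div_nhds_zero
  have h2 : Tendsto (fun n : ℕ => Real.log (Nat.factorial (m - 1)) / Real.log n) atTop (𝓝 0) :=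
    tendsto_const_nhds.div_atTop tendsto_log_natCast_atTop
  have := (h1.const_mul ((m : ℝ) - 1)).sub h2
  simp only [mul_zero, sub_zero] at this
  refine this.congr fun n => ?_
  rw [centering]
  ring

theorem tendsto_div_log_of_tendsto {m : ℕ} {y : ℕ → ℝ} {x : ℝ}
    (hy : Tendsto (fun n => y n - Real.log n - centering m n) atTop (𝓝 x)) :
    Tendsto (fun n => y n / Real.log n) atTop (𝓝 1) := by
  have h := ((hy.div_atTop tendsto_log_natCast_atTop).add (tendsto_centering_div_log m)).add_const 1
  simp only [zero_add] at h
  refine h.congr' ?_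
  filter_upwards [tendsto_log_natCast_atTop.eventually_gt_atTop 0] with n hn
  field_simp
  ring

theorem tendsto_atTop_of_div_log {y : ℕ → ℝ}
    (hy : Tendsto (fun n => y n / Real.log n) atTop (𝓝 1)) : Tendsto y atTop atTop := by
  refine (hy.pos_mul_atTop one_pos tendsto_log_natCast_atTop).congr' ?_
  filter_upwards [tendsto_log_natCast_atTop.eventually_gt_atTop 0] with n hn
  field_simp

/-- The last term of the sum dominates the gamma tail. -/
theorem tendsto_gammaTail_ratio (N : ℕ) :
    Tendsto (fun y : ℝ => gammaTail N y / (Real.exp (-y) * y ^ N / N.factorial)) atTop (𝓝 1) := by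
  have h : Tendsto (fun y : ℝ => ∑ j ∈ Finset.range N, (y ^ j / y ^ N) *
      (N.factorial / j.factorial : ℝ) + 1) atTop (𝓝 (∑ j ∈ Finset.range N, 0 *
        (N.factorial / j.factorial : ℝ) + 1)) := by
    refine (tendsto_finsetSum _ fun j hj => ?_).add_const 1
    exact (tendsto_pow_div_pow_atTop_zero (Finset.mem_range.1 hj)).mul_const _
  simp only [zero_mul, Finset.sum_const_zero, zero_add] at h
  refine h.congr' ?_
  filter_upwards [eventually_gt_atTop 0] with y hy
  have hf : (0 : ℝ) < N.factorial := by positivity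
  have he := Real.exp_pos (-y)
  rw [gammaTail, eq_div_iff (by positivity), Finset.sum_range_succ, add_mul, Finset.sum_mul,
    mul_add, Finset.mul_sum]
  congr 1
  · refine Finset.sum_congr rfl fun j _ => ?_
    have hj : (0 : ℝ) < j.factorial := by positivity
    field_simp
  · ring

theorem tendsto_mul_gammaTail (N : ℕ) {y : ℕ → ℝ} {x : ℝ}
    (hy : Tendsto (fun n => y n - Real.log n - centering (N + 1) n) atTop (𝓝 x)) :
    Tendsto (fun n : ℕ => n * gammaTail N (y n)) atTop (𝓝 (Real.exp (-x))) := by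
  have h1 := tendsto_div_log_of_tendsto hy
  have h2 := tendsto_atTop_of_div_log h1
  have h3 := ((Real.continuous_exp.tendsto _).comp hy.neg).mul
    ((h1.pow N).mul ((tendsto_gammaTail_ratio N).comp h2))
  simp only [one_pow, mul_one] at h3
  refine h3.congr' ?_
  filter_upwards [tendsto_log_natCast_atTop.eventually_gt_atTop 0, h2.eventually_gt_atTop 0,
    eventually_gt_atTop 0] with n hn hyn hn0
  simp only [Function.comp]
  have hn0' : (0 : ℝ) < n := by exact_mod_cast hn0
  have hf : (0 : ℝ) < N.factorial := by positivity
  have he : Real.exp (-(y n - Real.log n - centering (N + 1) n)) =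
      Real.exp (-y n) * n * (Real.log n ^ N / N.factorial) := by
    have : -(y n - Real.log n - centering (N + 1) n) =
        -y n + Real.log n + (N * Real.log (Real.log n) - Real.log N.factorial) := by
      rw [centering, Nat.add_sub_cancel]
      push_cast
      ring
    rw [this, Real.exp_add, Real.exp_add, Real.exp_log hn0', Real.exp_sub, Real.exp_log hf,
      Real.exp_nat_mul, Real.exp_log hn]
  rw [he, div_pow]
  have hexp := Real.exp_pos (-y n)
  field_simp

theorem tendsto_gammaMeasure_Iio_pow (N : ℕ) {y : ℕ → ℝ} {x : ℝ}
    (hy : Tendsto (fun n => y n - Real.log n - centering (N + 1) n) atTop (𝓝 x)) :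
    Tendsto (fun n : ℕ => (gammaMeasure ((N + 1 : ℕ) : ℝ) 1).real (Set.Iio (y n)) ^ n) atTop
      (𝓝 (Real.exp (-Real.exp (-x)))) := by
  have h1 := (tendsto_mul_gammaTail N hy).neg
  have h2 : Tendsto (fun n : ℕ => (n : ℝ) * (-gammaTail N (y n))) atTop
      (𝓝 (-Real.exp (-x))) := h1.congr fun n => by ring
  refine (Real.tendsto_one_add_pow_exp_of_tendsto h2).congr' ?_
  filter_upwards [(tendsto_atTop_of_div_log (tendsto_div_log_of_tendsto hy)).eventually_ge_atTop 0]
    with n hn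
  rw [gammaMeasure_real_Iio N hn, sub_eq_add_neg]

/-- The starting points of the `n` aligned windows of length `m`. -/
def blockStarts (m n : ℕ) : Finset ℕ := (Finset.range n).image (· * m)

theorem expSeq_truncate_blocks (N n k : ℕ) (hk : k = (N + 1) * n) (t : ℝ) :
    expSeq.real {e | truncate k e ∈ windowsLt (N + 1) (blockStarts (N + 1) n) t} =
      (gammaMeasure ((N + 1 : ℕ) : ℝ) 1).real (Set.Iio t) ^ n := by
  rw [← expSeq_blocks]
  congr 1
  ext e
  simp only [windowsLt, blockStarts, Set.mem_ofPred_eq, Finset.forall_mem_image, Finset.mem_range]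
  refine forall₂_congr fun s hs => ?_
  have : window (N + 1) (truncate k e) (s * (N + 1)) = window (N + 1) e (s * (N + 1)) := by
    refine Finset.sum_congr rfl fun j hj => ?_
    refine if_pos ?_
    have hj' := Finset.mem_range.1 hj
    have h1 : (s + 1) * (N + 1) ≤ n * (N + 1) := Nat.mul_le_mul_right _ hs
    rw [hk, mul_comm (N + 1) n]
    linarith [add_one_mul s (N + 1)]
  rw [this]

/-- The probability that all aligned windows of the spacings of uniform points are shorter than `t`
when there are `n` windows of `m` spacings each. -/
def blockProb (m n : ℕ) (t : ℝ) : ℝ :=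
  (uniformCube (m * n - 1)).real {u | spacing u ∈ windowsLt m (blockStarts m n) t}

theorem blockProb_bounds (N n : ℕ) (hn : 0 < n) {z η : ℝ} (hz : 0 ≤ z) (hη : 0 < η) (hη1 : η ≤ 1) :
    (gammaMeasure ((N + 1 : ℕ) : ℝ) 1).real (Set.Iio (z * (1 - η))) ^ n -
        1 / (((N + 1) * n : ℕ) * η ^ 2) ≤ blockProb (N + 1) n (z / ((N + 1) * n : ℕ)) ∧
    blockProb (N + 1) n (z / ((N + 1) * n : ℕ)) * (1 - 1 / (((N + 1) * n : ℕ) * η ^ 2)) ≤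
      (gammaMeasure ((N + 1 : ℕ) : ℝ) 1).real (Set.Iio (z * (1 + η))) ^ n := by
  obtain ⟨K, hK⟩ : ∃ K, (N + 1) * n = K + 1 :=
    ⟨(N + 1) * n - 1, (Nat.sub_add_cancel (Nat.mul_pos N.succ_pos hn)).symm⟩
  have ht : 0 ≤ z / ((K + 1 : ℕ) : ℝ) := by positivity
  have h1 := le_uniformCube_windowsLt (N + 1) K (blockStarts (N + 1) n) ht hη hη1
  have h2 := uniformCube_windowsLt_mul_le (N + 1) K (blockStarts (N + 1) n) ht hη hη1
  have hK0 : ((K + 1 : ℕ) : ℝ) ≠ 0 := by positivity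
  rw [expSeq_truncate_blocks N n (K + 1) hK.symm] at h1 h2
  unfold blockProb
  rw [hK, Nat.add_sub_cancel]
  rw [show z / ((K + 1 : ℕ) : ℝ) * ((1 - η) * ((K + 1 : ℕ) : ℝ)) = z * (1 - η) by
    field_simp] at h1
  rw [show z / ((K + 1 : ℕ) : ℝ) * ((1 + η) * ((K + 1 : ℕ) : ℝ)) = z * (1 + η) by
    field_simp] at h2
  exact ⟨h1, h2⟩

/-- The longest aligned window of spacings, suitably centred, is asymptotically Gumbel. -/
theorem tendsto_blockProb (N : ℕ) {z : ℕ → ℝ} {x : ℝ}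
    (hz : Tendsto (fun n => z n - Real.log n - centering (N + 1) n) atTop (𝓝 x)) :
    Tendsto (fun n : ℕ => blockProb (N + 1) n (z n / ((N + 1) * n : ℕ))) atTop
      (𝓝 (Real.exp (-Real.exp (-x)))) := by
  -- `n^(-1/4)` is negligible against `1 / log n`, yet large against the relative fluctuations
  -- of order `n^(-1/2)` of the sum of the exponential variables.
  set η : ℕ → ℝ := fun n => (n : ℝ) ^ (-(1 / 4 : ℝ)) with hη
  have hη0 : Tendsto η atTop (𝓝 0) :=
    (tendsto_rpow_neg_atTop (by norm_num)).comp tendsto_natCast_atTop_atTop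
  have hlogη : Tendsto (fun n : ℕ => Real.log n * η n) atTop (𝓝 0) := by
    have := ((isLittleO_log_rpow_atTop (r := 1 / 4) (by norm_num)).comp_tendsto
      (tendsto_natCast_atTop_atTop (R := ℝ))).tendsto_div_nhds_zero
    refine this.congr fun n => ?_
    simp only [Function.comp, hη]
    rw [Real.rpow_neg (Nat.cast_nonneg n), div_eq_mul_inv]
  have hz1 := tendsto_div_log_of_tendsto hz
  have hzη : Tendsto (fun n => z n * η n) atTop (𝓝 0) := by
    have := hz1.mul hlogη
    rw [one_mul] at this
    refine this.congr' ?_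
    filter_upwards [tendsto_log_natCast_atTop.eventually_gt_atTop 0] with n hn
    field_simp
  have hδ : Tendsto (fun n : ℕ => 1 / ((((N + 1) * n : ℕ) : ℝ) * η n ^ 2)) atTop (𝓝 0) := by
    have h1 : Tendsto (fun n : ℕ => ((N : ℝ) + 1) * (n : ℝ) ^ (1 / 2 : ℝ)) atTop atTop :=
      ((tendsto_rpow_atTop (by norm_num)).comp tendsto_natCast_atTop_atTop).const_mul_atTop
        (by positivity)
    refine ((tendsto_const_nhds (x := (1 : ℝ))).div_atTop h1).congr' ?_
    filter_upwards [eventually_gt_atTop 0] with n hn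
    have hn' : (0 : ℝ) < n := by exact_mod_cast hn
    have : (n : ℝ) * η n ^ 2 = (n : ℝ) ^ (1 / 2 : ℝ) := by
      simp only [hη]
      rw [← Real.rpow_natCast, ← Real.rpow_mul hn'.le]
      nth_rewrite 1 [← Real.rpow_one (n : ℝ)]
      rw [← Real.rpow_add hn']
      norm_num
    rw [← this]
    push_cast
    ring_nf
  have hlow := tendsto_gammaMeasure_Iio_pow N (y := fun n => z n * (1 - η n)) (x := x) (by
    have := hz.sub hzη
    rw [sub_zero] at this
    exact this.congr fun n => by ring)
  have hup := tendsto_gammaMeasure_Iio_pow N (y := fun n => z n * (1 + η n)) (x := x) (by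
    have := hz.add hzη
    rw [add_zero] at this
    exact this.congr fun n => by ring)
  have hlow' := hlow.sub hδ
  have hup' := hup.div (hδ.const_sub 1) (by norm_num)
  rw [sub_zero] at hlow'
  rw [sub_zero, div_one] at hup'
  have hev : ∀ᶠ n in atTop, 0 < n ∧ 0 ≤ z n ∧ 0 < η n ∧ η n ≤ 1 := by
    filter_upwards [eventually_gt_atTop 0,
      (tendsto_atTop_of_div_log hz1).eventually_ge_atTop 0,
      hη0.eventually_le_const one_pos] with n h1 h2 h3
    exact ⟨h1, h2, Real.rpow_pos_of_pos (by exact_mod_cast h1) _, h3⟩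
  refine tendsto_of_tendsto_of_tendsto_of_le_of_le' hlow' hup' ?_ ?_
  · filter_upwards [hev] with n ⟨h1, h2, h3, h4⟩
    exact (blockProb_bounds N n h1 h2 h3 h4).1
  · filter_upwards [hev, hδ.eventually_lt_const one_pos] with n ⟨h1, h2, h3, h4⟩ h5
    simp only [Pi.div_apply]
    rw [le_div_iff₀ (sub_pos.2 h5)]
    exact (blockProb_bounds N n h1 h2 h3 h4).2


/-! ### Monotonicity of the longest window in the number of points -/

theorem window_spacing {N : ℕ} (u : Fin N → ℝ) (m i : ℕ) :
    window m (spacing u) i = orderStat u (i + m) - orderStat u i := by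
  have := Finset.sum_range_sub (fun j => orderStat u (i + j)) m
  simpa [window, spacing, add_assoc] using this

theorem orderStat_succ {N : ℕ} (u : Fin N → ℝ) {i : ℕ} (h : i < N) :
    orderStat u (i + 1) = u (Tuple.sort u ⟨i, h⟩) := by
  simp [orderStat, h]

theorem orderStat_nonneg {N : ℕ} {u : Fin N → ℝ} (hu : ∀ l, u l ∈ Set.Icc (0 : ℝ) 1) (i : ℕ) :
    0 ≤ orderStat u i := by
  unfold orderStat
  split_ifs
  · exact le_rfl
  · exact (hu _).1
  · exact zero_le_one

theorem orderStat_le_one {N : ℕ} {u : Fin N → ℝ} (hu : ∀ l, u l ∈ Set.Icc (0 : ℝ) 1) (i : ℕ) :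
    orderStat u i ≤ 1 := by
  unfold orderStat
  split_ifs
  · exact zero_le_one
  · exact (hu _).2
  · exact le_rfl

theorem card_filter_comp_sort {N : ℕ} (u : Fin N → ℝ) (p : ℝ → Prop) [DecidablePred p] :
    (Finset.univ.filter fun l => p (u (Tuple.sort u l))).card =
      (Finset.univ.filter fun l => p (u l)).card := by
  refine Finset.card_equiv (Tuple.sort u) fun l => ?_
  simp

/-- Fewer than `m` points lie strictly between the endpoints of a window of `m` spacings. -/
theorem card_between_orderStat_lt {N : ℕ} {u : Fin N → ℝ}
    (hu : ∀ l, u l ∈ Set.Icc (0 : ℝ) 1) {m : ℕ} (hm : 0 < m) (i : ℕ) :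
    (Finset.univ.filter fun l => orderStat u i < u l ∧ u l < orderStat u (i + m)).card < m := by
  have hmono := Tuple.monotone_sort u
  rw [← card_filter_comp_sort u fun x => orderStat u i < x ∧ x < orderStat u (i + m)]
  have hsub : ((Finset.univ.filter fun l => orderStat u i < u (Tuple.sort u l) ∧
      u (Tuple.sort u l) < orderStat u (i + m)).map Fin.valEmbedding) ⊆
      Finset.Ico i (i + m - 1) := by
    intro l hl
    simp only [Finset.mem_map, Finset.mem_filter, Finset.mem_univ, true_and,
      Fin.valEmbedding_apply] at hl
    obtain ⟨l, ⟨h1, h2⟩, rfl⟩ := hl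
    rw [Finset.mem_Ico]
    constructor
    · by_contra h
      obtain ⟨i, rfl⟩ : ∃ j, i = j + 1 := ⟨i - 1, by omega⟩
      by_cases hi : i < N
      · rw [orderStat_succ u hi] at h1
        exact absurd (hmono (show l ≤ ⟨i, hi⟩ from Fin.mk_le_mk.2 (by omega))) (not_le.2 h1)
      · simp only [orderStat, Nat.add_one_ne_zero, if_false, Nat.add_sub_cancel, dif_neg hi] at h1
        exact absurd (hu _).2 (not_le.2 h1)
    · by_contra h
      have hlt : i + m - 1 < N := by omega
      have : i + m = i + m - 1 + 1 := by omega
      rw [this, orderStat_succ u hlt] at h2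
      exact absurd (hmono (show (⟨i + m - 1, hlt⟩ : Fin N) ≤ l from Fin.mk_le_mk.2 (by omega)))
        (not_le.2 h2)
  have := Finset.card_le_card hsub
  rw [Finset.card_map, Nat.card_Ico] at this
  omega

/-- An interval with fewer than `m` points in its interior lies inside a window of `m` spacings. -/
theorem exists_window_of_card_lt {N : ℕ} {u : Fin N → ℝ} {m : ℕ} {a b : ℝ} (ha : 0 ≤ a)
    (hb : b ≤ 1) (h : (Finset.univ.filter fun l => a < u l ∧ u l < b).card < m) :
    ∃ i ≤ N, b - a ≤ window m (spacing u) i := by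
  have hmono := Tuple.monotone_sort u
  set c := (Finset.univ.filter fun l => (u ∘ Tuple.sort u) l ≤ a).card with hc
  have hcN : c ≤ N := (Finset.card_le_univ _).trans_eq (Fintype.card_fin N)
  refine ⟨c, hcN, ?_⟩
  rw [window_spacing]
  have h1 : orderStat u c ≤ a := by
    rcases Nat.eq_zero_or_pos c with h0 | h0
    · rw [h0]
      simpa [orderStat] using ha
    · have hlt : c - 1 < N := by omega
      rw [show c = c - 1 + 1 by omega, orderStat_succ u hlt]
      exact (Tuple.lt_card_le_iff_apply_le_of_monotone (j := ⟨c - 1, hlt⟩) hmono).1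
        (show c - 1 < c by omega)
  have h2 : b ≤ orderStat u (c + m) := by
    have hcm : c + m ≠ 0 := by omega
    by_cases hlt : c + m - 1 < N
    · rw [show c + m = c + m - 1 + 1 by omega, orderStat_succ u hlt]
      by_contra hlt'
      have h3 := (Tuple.lt_card_lt_iff_apply_lt_of_monotone (j := ⟨c + m - 1, hlt⟩) hmono).2
        (not_le.1 hlt')
      have h4 : (Finset.univ.filter fun l => (u ∘ Tuple.sort u) l < b).card ≤
          c + (Finset.univ.filter fun l =>
            a < u (Tuple.sort u l) ∧ u (Tuple.sort u l) < b).card := by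
        rw [hc]
        refine (Finset.card_le_card fun l hl => ?_).trans (Finset.card_union_le _ _)
        simp only [Finset.mem_filter, Finset.mem_univ, true_and, Finset.mem_union,
          Function.comp] at hl ⊢
        by_cases h5 : u (Tuple.sort u l) ≤ a
        · exact Or.inl h5
        · exact Or.inr ⟨not_le.1 h5, hl⟩
      rw [card_filter_comp_sort u fun x => a < x ∧ x < b] at h4
      simp only at h3
      omega
    · rwa [orderStat, if_neg hcm, dif_neg hlt]
  linarith

/-- If all windows of `m` spacings of the first `N` points are short, they remain short when more
points are added. -/
theorem windowsLt_of_le {U : ℕ → ℝ} (hU : ∀ j, U j ∈ Set.Icc (0 : ℝ) 1) {m N N' : ℕ} (hm : 0 < m)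
    (hN : N ≤ N') {t : ℝ}
    (h : spacing (fun l : Fin N => U l) ∈ windowsLt m (Finset.range (N + 1)) t) (I : Finset ℕ) :
    spacing (fun l : Fin N' => U l) ∈ windowsLt m I t := by
  intro i _
  by_contra hlt
  rw [not_lt, window_spacing] at hlt
  set a := orderStat (fun l : Fin N' => U l) i
  set b := orderStat (fun l : Fin N' => U l) (i + m)
  have hcard := card_between_orderStat_lt (u := fun l : Fin N' => U l) (fun l => hU l) hm i
  have hle : (Finset.univ.filter fun l : Fin N => a < U l ∧ U l < b).card ≤
      (Finset.univ.filter fun l : Fin N' => a < U l ∧ U l < b).card := by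
    refine Finset.card_le_card_of_injOn (Fin.castLE hN) (fun l hl => ?_)
      (Fin.castLE_injective hN).injOn
    simpa using hl
  obtain ⟨j, hj, hw⟩ := exists_window_of_card_lt (u := fun l : Fin N => U l)
    (orderStat_nonneg (fun l => hU l) i) (orderStat_le_one (fun l => hU l) (i + m))
    (hle.trans_lt hcard)
  have := h j (Finset.mem_range.2 (by omega))
  linarith

/-! ### Almost sure behaviour of the longest window -/

theorem exp_neg_le_gammaTail (N : ℕ) {y : ℝ} (hy : 0 ≤ y) : Real.exp (-y) ≤ gammaTail N y := by
  refine le_mul_of_one_le_right (Real.exp_nonneg _) ?_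
  have := Finset.single_le_sum (f := fun j => y ^ j / (j.factorial : ℝ))
    (fun j _ => by positivity) (Finset.mem_range.2 N.succ_pos)
  simpa using this

theorem gammaTail_le (N : ℕ) {y δ : ℝ} (hy : 0 ≤ y) (hδ : 0 < δ) (hδ1 : δ ≤ 1) :
    gammaTail N y ≤ (δ ^ N)⁻¹ * Real.exp (-((1 - δ) * y)) := by
  have h1 : ∑ j ∈ Finset.range (N + 1), y ^ j / j.factorial ≤
      (δ ^ N)⁻¹ * ∑ j ∈ Finset.range (N + 1), (δ * y) ^ j / j.factorial := by
    rw [Finset.mul_sum]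
    refine Finset.sum_le_sum fun j hj => ?_
    have h2 : δ ^ N ≤ δ ^ j :=
      pow_le_pow_of_le_one hδ.le hδ1 (Nat.lt_succ_iff.1 (Finset.mem_range.1 hj))
    rw [mul_pow, inv_mul_eq_div, le_div_iff₀ (by positivity)]
    have : 0 ≤ y ^ j / (j.factorial : ℝ) := by positivity
    calc y ^ j / (j.factorial : ℝ) * δ ^ N ≤ y ^ j / (j.factorial : ℝ) * δ ^ j :=
          mul_le_mul_of_nonneg_left h2 this
      _ = δ ^ j * y ^ j / (j.factorial : ℝ) := by ring
  have h2 := Real.sum_le_exp_of_nonneg (mul_nonneg hδ.le hy) (N + 1)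
  calc gammaTail N y ≤ Real.exp (-y) * ((δ ^ N)⁻¹ * Real.exp (δ * y)) :=
        mul_le_mul_of_nonneg_left
          (h1.trans (mul_le_mul_of_nonneg_left h2 (by positivity))) (Real.exp_nonneg _)
    _ = (δ ^ N)⁻¹ * Real.exp (-((1 - δ) * y)) := by
        rw [mul_left_comm, ← Real.exp_add]
        ring_nf

theorem summable_exp_neg_rpow {a : ℝ} (ha : 0 < a) :
    Summable fun n : ℕ => Real.exp (-(n : ℝ) ^ a) := by
  have h1 : Tendsto (fun n : ℕ => (n : ℝ) ^ a) atTop atTop :=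
    (tendsto_rpow_atTop ha).comp tendsto_natCast_atTop_atTop
  have h2 := (isLittleO_exp_neg_mul_rpow_atTop one_pos (-2 / a)).comp_tendsto h1
  refine summable_of_isBigO_nat (Real.summable_nat_rpow.2 (by norm_num : (-2 : ℝ) < -1)) ?_
  refine (h2.congr (fun n => ?_) fun n => ?_).isBigO
  · simp
  · simp only [Function.comp]
    rw [← Real.rpow_mul (Nat.cast_nonneg n)]
    congr 1
    field_simp

/-- The probability that all aligned windows are shorter than `(1 - ε) log n / (m n)` is
summable. -/
theorem summable_blockProb (N : ℕ) {ε : ℝ} (hε : 0 < ε) (hε1 : ε ≤ 1) :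
    Summable fun n : ℕ =>
      blockProb (N + 1) n ((1 - ε) * Real.log n / ((N + 1) * n : ℕ)) := by
  have hs : Summable fun n : ℕ => 2 * Real.exp (-(n : ℝ) ^ (ε / 2)) :=
    (summable_exp_neg_rpow (half_pos hε)).mul_left 2
  refine hs.of_norm_bounded_eventually_nat ?_
  have hδ : Tendsto (fun n : ℕ => 1 / ((((N + 1) * n : ℕ) : ℝ) * (ε / 2) ^ 2)) atTop (𝓝 0) := by
    refine (tendsto_const_nhds (x := (1 : ℝ))).div_atTop ?_
    refine Tendsto.atTop_mul_const (by positivity) ?_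
    exact tendsto_natCast_atTop_atTop.comp (tendsto_id.const_mul_atTop' N.succ_pos)
  filter_upwards [eventually_gt_atTop 0, tendsto_log_natCast_atTop.eventually_gt_atTop 0,
    hδ.eventually_le_const one_half_pos] with n hn hlog hδn
  have hn' : (0 : ℝ) < n := by exact_mod_cast hn
  -- With `η = ε / 2` the threshold stays below: `(1 - ε) (1 + ε / 2) ≤ 1 - ε / 2`.
  have h1 := (blockProb_bounds N n hn (z := (1 - ε) * Real.log n) (η := ε / 2)
    (mul_nonneg (by linarith) hlog.le) (by positivity) (by linarith)).2
  have h2 : (gammaMeasure ((N + 1 : ℕ) : ℝ) 1).real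
      (Set.Iio ((1 - ε) * Real.log n * (1 + ε / 2))) ^ n ≤ Real.exp (-(n : ℝ) ^ (ε / 2)) := by
    have hy : 0 ≤ (1 - ε / 2) * Real.log n := mul_nonneg (by linarith) hlog.le
    have h3 : (gammaMeasure ((N + 1 : ℕ) : ℝ) 1).real
        (Set.Iio ((1 - ε) * Real.log n * (1 + ε / 2))) ≤
          1 - Real.exp (-((1 - ε / 2) * Real.log n)) := by
      refine (measureReal_mono (Set.Iio_subset_Iio
        (show (1 - ε) * Real.log n * (1 + ε / 2) ≤ (1 - ε / 2) * Real.log n by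
          nlinarith [mul_pos (pow_pos hε 2) hlog]))).trans ?_
      rw [gammaMeasure_real_Iio N hy]
      linarith [exp_neg_le_gammaTail N hy]
    have h4 : (1 : ℝ) - Real.exp (-((1 - ε / 2) * Real.log n)) ≤
        Real.exp (-Real.exp (-((1 - ε / 2) * Real.log n))) := by
      have := Real.add_one_le_exp (-Real.exp (-((1 - ε / 2) * Real.log n)))
      linarith
    refine (pow_le_pow_left₀ measureReal_nonneg (h3.trans h4) n).trans_eq ?_
    rw [← Real.exp_nat_mul]
    congr 1
    rw [mul_neg, neg_inj, Real.rpow_def_of_pos hn']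
    nth_rewrite 1 [← Real.exp_log hn']
    rw [← Real.exp_add]
    ring_nf
  have h0 : 0 ≤ blockProb (N + 1) n ((1 - ε) * Real.log n / ((N + 1) * n : ℕ)) :=
    measureReal_nonneg
  rw [Real.norm_of_nonneg h0]
  nlinarith

/-- The probability that some window of `m` spacings is at least `(1 + ε) log n / (m n)` decays
like a power of `n`. -/
theorem exists_window_prob_le (N : ℕ) {ε : ℝ} (hε : 0 < ε) (hε1 : ε ≤ 1) :
    ∃ C : ℝ, ∀ n : ℕ, 0 < n →
      1 - (uniformCube ((N + 1) * n - 1)).real {u | spacing u ∈ windowsLt (N + 1)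
        (Finset.range ((N + 1) * n - 1 + 1)) ((1 + ε) * Real.log n / ((N + 1) * n : ℕ))} ≤
      C * (n : ℝ) ^ (-(ε / 4)) := by
  refine ⟨(N + 1) * ((ε / 8) ^ N)⁻¹ + 1 / (ε / 4) ^ 2, fun n hn => ?_⟩
  have hn' : (1 : ℝ) ≤ n := by exact_mod_cast hn
  have hn0 : (0 : ℝ) < n := by linarith
  have hlog : 0 ≤ Real.log n := Real.log_nonneg hn'
  obtain ⟨K, hK⟩ : ∃ K, (N + 1) * n = K + 1 :=
    ⟨(N + 1) * n - 1, (Nat.sub_add_cancel (Nat.mul_pos N.succ_pos hn)).symm⟩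
  have hKr : ((K + 1 : ℕ) : ℝ) = (N + 1) * n := by
    rw [← hK]
    push_cast
    ring
  have hK0 : (0 : ℝ) < ((K + 1 : ℕ) : ℝ) := by positivity
  rw [hK, Nat.add_sub_cancel]
  set t := (1 + ε) * Real.log n / ((K + 1 : ℕ) : ℝ) with ht
  -- `η = ε / 4` leaves `(1 + ε) (1 - ε / 4) ≥ 1 + ε / 2`. In the tail bound the rate `1 - ε / 8`
  -- then gives `(1 - ε / 8) (1 + ε / 2) ≥ 1 + ε / 4`, which absorbs the factor `n` of
  -- the union bound.
  have h1 := le_uniformCube_windowsLt (N + 1) K (Finset.range (K + 1)) (t := t) (η := ε / 4)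
    (by positivity) (by positivity) (by linarith)
  have ht' : t * ((1 - ε / 4) * ((K + 1 : ℕ) : ℝ)) = (1 + ε) * (1 - ε / 4) * Real.log n := by
    rw [ht]
    field_simp
  rw [ht'] at h1
  set y := (1 + ε) * (1 - ε / 4) * Real.log n with hy
  have hy1 : (1 + ε / 2) * Real.log n ≤ y :=
    mul_le_mul_of_nonneg_right (by nlinarith) hlog
  have hy0 : 0 ≤ y := le_trans (by positivity) hy1
  have h2 : 1 - expSeq.real {e | truncate (K + 1) e ∈ windowsLt (N + 1) (Finset.range (K + 1)) y} ≤
      ((K + 1 : ℕ) : ℝ) * gammaTail N y := by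
    have hmeas : MeasurableSet
        {e | truncate (K + 1) e ∈ windowsLt (N + 1) (Finset.range (K + 1)) y} :=
      measurable_truncate (K + 1) (measurableSet_windowsLt _ _ _)
    rw [← probReal_compl_eq_one_sub hmeas]
    have hsub : ({e | truncate (K + 1) e ∈ windowsLt (N + 1) (Finset.range (K + 1)) y}ᶜ :
        Set (ℕ → ℝ)) ≤ᵐ[expSeq]
        ⋃ i ∈ Finset.range (K + 1), {e | window (N + 1) e i ∈ Set.Ici y} := by
      filter_upwards [ae_expSeq_nonneg] with e he h
      have h' : ¬ ∀ i ∈ Finset.range (K + 1), window (N + 1) (truncate (K + 1) e) i < y := h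
      push Not at h'
      obtain ⟨i, hi, hw⟩ := h'
      refine Set.mem_biUnion hi (hw.trans (Finset.sum_le_sum fun j _ => ?_))
      unfold truncate
      split_ifs
      exacts [le_rfl, he _]
    refine (ENNReal.toReal_mono (measure_ne_top _ _) (measure_mono_ae hsub)).trans
      ((measureReal_biUnion_finset_le _ _).trans_eq ?_)
    rw [Finset.sum_congr rfl fun i _ => show expSeq.real {e | window (N + 1) e i ∈ Set.Ici y} =
      gammaTail N y by
        rw [Measure.real, expSeq_window N i measurableSet_Ici, ← gammaMeasure_real_Ici N hy0]
        rfl, Finset.sum_const, Finset.card_range, nsmul_eq_mul]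
  have h3 : gammaTail N y ≤ ((ε / 8) ^ N)⁻¹ * ((n : ℝ) ^ (-(ε / 4)) * (n : ℝ)⁻¹) := by
    refine (gammaTail_le N hy0 (by positivity : 0 < ε / 8) (by linarith)).trans ?_
    refine mul_le_mul_of_nonneg_left ?_ (by positivity)
    rw [← Real.rpow_neg_one (n : ℝ), ← Real.rpow_add hn0, Real.rpow_def_of_pos hn0]
    refine Real.exp_le_exp.2 ?_
    have : (1 - ε / 8) * ((1 + ε / 2) * Real.log n) ≤ (1 - ε / 8) * y :=
      mul_le_mul_of_nonneg_left hy1 (by linarith)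
    nlinarith [mul_nonneg hε.le hlog, mul_nonneg (mul_nonneg hε.le (sub_nonneg.2 hε1)) hlog]
  have h4 : 1 / (((K + 1 : ℕ) : ℝ) * (ε / 4) ^ 2) ≤
      1 / (ε / 4) ^ 2 * (n : ℝ) ^ (-(ε / 4)) := by
    have h5 : (n : ℝ)⁻¹ ≤ (n : ℝ) ^ (-(ε / 4)) := by
      rw [← Real.rpow_neg_one (n : ℝ)]
      exact Real.rpow_le_rpow_of_exponent_le hn' (by linarith)
    have h6 : 1 / ((K + 1 : ℕ) : ℝ) ≤ (n : ℝ)⁻¹ := by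
      rw [one_div]
      refine inv_anti₀ hn0 ?_
      rw [hKr]
      nlinarith [(Nat.cast_nonneg N : (0 : ℝ) ≤ N)]
    rw [mul_comm (1 / (ε / 4) ^ 2), mul_one_div, ← div_div]
    exact div_le_div_of_nonneg_right (h6.trans h5) (by positivity)
  have h7 : ((K + 1 : ℕ) : ℝ) * gammaTail N y ≤
      (N + 1) * ((ε / 8) ^ N)⁻¹ * (n : ℝ) ^ (-(ε / 4)) := by
    refine (mul_le_mul_of_nonneg_left h3 hK0.le).trans_eq ?_
    rw [hKr]
    field_simp
  linarith


/-- A summable sequence of probabilities: almost surely only finitely many of the events occur. -/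
theorem ae_eventually_notMem_of_summable {Ω : Type*} [MeasurableSpace Ω] {P : Measure Ω}
    [IsFiniteMeasure P] {s : ℕ → Set Ω} (h : Summable fun n => P.real (s n)) :
    ∀ᵐ ω ∂P, ∀ᶠ n in atTop, ω ∉ s n := by
  refine ae_eventually_notMem ?_
  have := h.tsum_ofReal_ne_top
  simpa [Measure.real, ENNReal.ofReal_toReal (measure_ne_top _ _)] using this

theorem measurableSet_spacing_windowsLt (N m : ℕ) (I : Finset ℕ) (t : ℝ) :
    MeasurableSet {u : Fin N → ℝ | spacing u ∈ windowsLt m I t} :=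
  (measurable_pi_iff.2 fun i => measurable_spacing (N := N) i) (measurableSet_windowsLt m I t)

section AlmostSure

variable {Ω : Type*} [MeasurableSpace Ω] {P : Measure Ω} {U : ℕ → Ω → ℝ}

theorem measureReal_spacing_windowsLt (hU : ∀ j, Measurable (U j))
    (hlaw : ∀ N, Measure.map (fun ω (l : Fin N) => U l ω) P = uniformCube N)
    (N m : ℕ) (I : Finset ℕ) (t : ℝ) :
    P.real {ω | spacing (fun l : Fin N => U l ω) ∈ windowsLt m I t} =
      (uniformCube N).real {u | spacing u ∈ windowsLt m I t} := by
  rw [← hlaw N, Measure.real, Measure.real, Measure.map_apply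
    (measurable_pi_iff.2 fun l => hU _) (measurableSet_spacing_windowsLt N m I t)]
  rfl

variable [IsProbabilityMeasure P]

theorem ae_eventually_notMem_windowsLt (hU : ∀ j, Measurable (U j))
    (hlaw : ∀ N, Measure.map (fun ω (l : Fin N) => U l ω) P = uniformCube N)
    (N : ℕ) {ε : ℝ} (hε : 0 < ε) (hε1 : ε ≤ 1) :
    ∀ᵐ ω ∂P, ∀ᶠ n : ℕ in atTop, spacing (fun l : Fin ((N + 1) * n - 1) => U l ω) ∉
      windowsLt (N + 1) (blockStarts (N + 1) n) ((1 - ε) * Real.log n / ((N + 1) * n : ℕ)) := by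
  refine ae_eventually_notMem_of_summable (s := fun n => {ω | spacing
    (fun l : Fin ((N + 1) * n - 1) => U l ω) ∈ windowsLt (N + 1) (blockStarts (N + 1) n)
      ((1 - ε) * Real.log n / ((N + 1) * n : ℕ))}) ?_
  simp only [measureReal_spacing_windowsLt hU hlaw]
  exact summable_blockProb N hε hε1

/-- Along the sparse sequence `n = j ^ K` the Borel–Cantelli lemma applies to the upper bound. -/
theorem exists_pow_ae_eventually_mem_windowsLt (hU : ∀ j, Measurable (U j))
    (hlaw : ∀ N, Measure.map (fun ω (l : Fin N) => U l ω) P = uniformCube N)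
    (N : ℕ) {ε : ℝ} (hε : 0 < ε) (hε1 : ε ≤ 1) :
    ∃ K : ℕ, 0 < K ∧ ∀ᵐ ω ∂P, ∀ᶠ j : ℕ in atTop,
      spacing (fun l : Fin ((N + 1) * j ^ K - 1) => U l ω) ∈
        windowsLt (N + 1) (Finset.range ((N + 1) * j ^ K - 1 + 1))
          ((1 + ε) * Real.log (j ^ K : ℕ) / ((N + 1) * j ^ K : ℕ)) := by
  -- For `n = j ^ K` with `K ≥ 8 / ε`, the bound `n ^ (-ε / 4)` is at most `j ^ (-2)`.
  obtain ⟨K, hK⟩ := exists_nat_ge (8 / ε)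
  have hK0 : 0 < K := by
    have : (0 : ℝ) < K := lt_of_lt_of_le (by positivity) hK
    exact_mod_cast this
  refine ⟨K, hK0, ?_⟩
  obtain ⟨C, hC⟩ := exists_window_prob_le N hε hε1
  have hmeas (j : ℕ) : MeasurableSet {ω | spacing (fun l : Fin ((N + 1) * j ^ K - 1) => U l ω) ∈
        windowsLt (N + 1) (Finset.range ((N + 1) * j ^ K - 1 + 1))
          ((1 + ε) * Real.log (j ^ K : ℕ) / ((N + 1) * j ^ K : ℕ))} :=
    (measurable_pi_iff.2 fun l : Fin ((N + 1) * j ^ K - 1) => hU l)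
      (measurableSet_spacing_windowsLt _ (N + 1) _ _)
  have hsum : Summable fun j : ℕ => P.real {ω | spacing
        (fun l : Fin ((N + 1) * j ^ K - 1) => U l ω) ∈
        windowsLt (N + 1) (Finset.range ((N + 1) * j ^ K - 1 + 1))
          ((1 + ε) * Real.log (j ^ K : ℕ) / ((N + 1) * j ^ K : ℕ))}ᶜ := by
    refine ((Real.summable_nat_rpow.2 (by norm_num : (-2 : ℝ) < -1)).mul_left
      |C|).of_norm_bounded_eventually_nat ?_
    filter_upwards [eventually_gt_atTop 0] with j hj
    have hj1 : (1 : ℝ) ≤ j := by exact_mod_cast hj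
    rw [Real.norm_of_nonneg measureReal_nonneg, probReal_compl_eq_one_sub (hmeas j),
      measureReal_spacing_windowsLt hU hlaw]
    refine (hC (j ^ K) (pow_pos hj K)).trans ?_
    refine mul_le_mul (le_abs_self C) ?_ (by positivity) (abs_nonneg C)
    push_cast
    rw [← Real.rpow_natCast, ← Real.rpow_mul (by positivity)]
    refine Real.rpow_le_rpow_of_exponent_le hj1 ?_
    rw [div_le_iff₀ hε] at hK
    linarith
  filter_upwards [ae_eventually_notMem_of_summable hsum] with ω hω
  filter_upwards [hω] with j hj
  exact not_not.1 hj

/-- Between consecutive members of the sparse sequence the upper bound persists, because adding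
points only shortens windows. -/
theorem ae_eventually_mem_windowsLt (hU : ∀ j, Measurable (U j))
    (hU01 : ∀ᵐ ω ∂P, ∀ j, U j ω ∈ Set.Icc (0 : ℝ) 1)
    (hlaw : ∀ N, Measure.map (fun ω (l : Fin N) => U l ω) P = uniformCube N)
    (N : ℕ) {ε : ℝ} (hε : 0 < ε) (hε1 : ε ≤ 1) :
    ∀ᵐ ω ∂P, ∀ᶠ n : ℕ in atTop, spacing (fun l : Fin ((N + 1) * n - 1) => U l ω) ∈
      windowsLt (N + 1) (blockStarts (N + 1) n)
        ((1 + 2 * ε) * Real.log n / ((N + 1) * n : ℕ)) := by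
  obtain ⟨K, hK0, hK⟩ := exists_pow_ae_eventually_mem_windowsLt hU hlaw N hε hε1
  have hratio : Tendsto (fun j : ℕ => (((j + 1 : ℕ) : ℝ) / j) ^ K) atTop (𝓝 1) := by
    have h1 : Tendsto (fun j : ℕ => ((j + 1 : ℕ) : ℝ) / j) atTop (𝓝 1) := by
      have := (tendsto_one_div_atTop_nhds_zero_nat (𝕜 := ℝ)).const_add 1
      rw [add_zero] at this
      refine this.congr' ?_
      filter_upwards [eventually_gt_atTop 0] with j hj
      have : (j : ℝ) ≠ 0 := by positivity
      push_cast
      field_simp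
    simpa using h1.pow K
  have hlt : (1 : ℝ) < (1 + 2 * ε) / (1 + ε) := by
    rw [one_lt_div (by positivity)]
    linarith
  filter_upwards [hK, hU01] with ω hω hω01
  obtain ⟨J, hJ⟩ := eventually_atTop.1 ((hω.and (hratio.eventually_lt_const hlt)).and
    (eventually_gt_atTop 0))
  refine eventually_atTop.2 ⟨J ^ K, fun n hn => ?_⟩
  have hex : ∃ j, n < (j + 1) ^ K :=
    ⟨n, (Nat.lt_succ_self n).trans_le (Nat.le_self_pow hK0.ne' _)⟩
  classical
  -- The `j` with `j ^ K ≤ n < (j + 1) ^ K`.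
  set j := Nat.find hex with hj
  have hj1 : n < (j + 1) ^ K := Nat.find_spec hex
  have hj2 : j ^ K ≤ n := by
    rcases Nat.eq_zero_or_pos j with h0 | h0
    · rw [h0, zero_pow hK0.ne']
      exact Nat.zero_le n
    · have := Nat.find_min hex (show j - 1 < j by omega)
      rw [Nat.sub_add_cancel h0] at this
      exact not_lt.1 this
  have hJj : J ≤ j := Nat.lt_succ_iff.1 (lt_of_pow_lt_pow_left₀ K (Nat.zero_le _) (hn.trans_lt hj1))
  obtain ⟨⟨h1, h2⟩, h3⟩ := hJ j hJj
  have hnj : (N + 1) * j ^ K - 1 ≤ (N + 1) * n - 1 :=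
    Nat.sub_le_sub_right (Nat.mul_le_mul_left _ hj2) 1
  refine windowsLt_mono ?_ (windowsLt_of_le (fun l => hω01 l) N.succ_pos hnj h1 _)
  have hjr : (0 : ℝ) < (j ^ K : ℕ) := by positivity
  have hjn : ((j ^ K : ℕ) : ℝ) ≤ n := by exact_mod_cast hj2
  have hnr : (0 : ℝ) < n := hjr.trans_le hjn
  have hlog : Real.log (j ^ K : ℕ) ≤ Real.log n := Real.log_le_log hjr hjn
  have hlogn : 0 ≤ Real.log n :=
    Real.log_nonneg (le_trans (by exact_mod_cast pow_pos h3 K) hjn)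
  have hn2 : (n : ℝ) * (1 + ε) ≤ (1 + 2 * ε) * (j ^ K : ℕ) := by
    have h4 : (n : ℝ) ≤ ((j + 1 : ℕ) : ℝ) ^ K := by exact_mod_cast hj1.le
    rw [div_pow, div_lt_div_iff₀ (by positivity) (by positivity)] at h2
    push_cast at h2 h4 ⊢
    have h5 := mul_le_mul_of_nonneg_right h4 (by positivity : 0 ≤ 1 + ε)
    linarith
  push_cast at hjr hlog hn2 ⊢
  rw [div_le_div_iff₀ (by positivity) (by positivity)]
  have h6 : (1 + ε) * Real.log (j ^ K) * n ≤ (1 + 2 * ε) * j ^ K * Real.log n := by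
    calc (1 + ε) * Real.log (j ^ K) * n = n * (1 + ε) * Real.log (j ^ K) := by ring
      _ ≤ n * (1 + ε) * Real.log n := mul_le_mul_of_nonneg_left hlog (by positivity)
      _ ≤ (1 + 2 * ε) * j ^ K * Real.log n := mul_le_mul_of_nonneg_right hn2 hlogn
  nlinarith [(Nat.cast_nonneg N : (0 : ℝ) ≤ N)]

end AlmostSure


/-! ### Node loads of a single-choice allocation -/

namespace StorageAllocation

variable {n k m : ℕ} {A : StorageAllocation n k}

theorem IsSingleChoice.mulVec_demandMatrix (h : A.IsSingleChoice m) (x : A.Portion → ℝ) (i : Fin k)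
    (c : Fin (A.numChoices i)) : (A.demandMatrix *ᵥ x) i = x ⟨i, c⟩ := by
  have huniq : ∀ c' : Fin (A.numChoices i), c' = c := fun c' => by
    have := h.numChoices_eq i
    exact Fin.ext (by omega)
  simp only [Matrix.mulVec, dotProduct, demandMatrix, Matrix.of_apply, ite_mul, one_mul, zero_mul]
  refine Fintype.sum_eq_single (⟨i, c⟩ : A.Portion) ?_ |>.trans (if_pos rfl)
  rintro ⟨j, c'⟩ hne
  refine if_neg fun hj => hne ?_
  simp only at hj
  subst hj
  rw [huniq c']

open Classical in
/-- Under a single-choice allocation the load of each node is the sum of the demands of the objects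
that it stores. -/
theorem IsSingleChoice.mulVec_loadMatrix (h : A.IsSingleChoice m) (x : A.Portion → ℝ) (s : Fin n) :
    (A.loadMatrix *ᵥ x) s = ∑ i, if A.Stores s i then (A.demandMatrix *ᵥ x) i else 0 := by
  simp only [Matrix.mulVec, dotProduct, loadMatrix, Matrix.of_apply, ite_mul, one_mul, zero_mul]
  rw [Fintype.sum_sigma]
  refine Finset.sum_congr rfl fun i _ => ?_
  have h1 := h.numChoices_eq i
  have h0 : 0 < A.numChoices i := by omega
  have huniq : ∀ c' : Fin (A.numChoices i), c' = ⟨0, h0⟩ := fun c' => Fin.ext (by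
    have := c'.2
    simp only
    omega)
  rw [Fintype.sum_eq_single ⟨0, h0⟩ fun c' hc' => absurd (huniq c') hc']
  have hx : x ⟨i, ⟨0, h0⟩⟩ = (A.demandMatrix *ᵥ x) i := (h.mulVec_demandMatrix x i _).symm
  rw [hx]
  refine if_congr ⟨fun hs => ⟨_, hs⟩, ?_⟩ rfl rfl
  rintro ⟨c', hs⟩
  rwa [huniq c'] at hs

open Classical in
/-- The vector of node loads under the demand `ρ`, when each object has a single service choice. -/
def nodeLoad (A : StorageAllocation n k) (ρ : Fin k → ℝ) (s : Fin n) : ℝ :=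
  ∑ i, if A.Stores s i then ρ i else 0

theorem IsSingleChoice.loadMatrix_eq_nodeLoad (h : A.IsSingleChoice m) {x : A.Portion → ℝ}
    {ρ : Fin k → ℝ} (hx : A.demandMatrix *ᵥ x = ρ) : A.loadMatrix *ᵥ x = A.nodeLoad ρ := by
  funext s
  rw [h.mulVec_loadMatrix, hx]
  rfl

theorem IsSingleChoice.demandMatrix_portions (h : A.IsSingleChoice m) (ρ : Fin k → ℝ) :
    A.demandMatrix *ᵥ (fun p => ρ p.1) = ρ := by
  funext i
  have h1 := h.numChoices_eq i
  exact h.mulVec_demandMatrix _ i ⟨0, by omega⟩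

theorem IsSingleChoice.minMaxLoad_eq (h : A.IsSingleChoice m) {ρ : Fin k → ℝ} (hρ : ∀ i, 0 ≤ ρ i) :
    A.minMaxLoad ρ = ‖A.nodeLoad ρ‖ := by
  have : {l | ∃ x : A.Portion → ℝ, A.demandMatrix *ᵥ x = ρ ∧ (∀ p, 0 ≤ x p) ∧
      l = ‖A.loadMatrix *ᵥ x‖} = {‖A.nodeLoad ρ‖} := by
    ext l
    constructor
    · rintro ⟨x, hx, _, rfl⟩
      rw [h.loadMatrix_eq_nodeLoad hx]
      rfl
    · rintro rfl
      have hx := h.demandMatrix_portions ρ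
      exact ⟨_, hx, fun p => hρ p.1, by rw [h.loadMatrix_eq_nodeLoad hx]⟩
  rw [minMaxLoad, this, csInf_singleton]

theorem IsSingleChoice.mem_capacityRegion_iff (h : A.IsSingleChoice m) {ρ : Fin k → ℝ}
    (hρ : ∀ i, 0 ≤ ρ i) : ρ ∈ A.capacityRegion ↔ ∀ s, A.nodeLoad ρ s < 1 := by
  constructor
  · rintro ⟨x, h1, hx, _⟩
    rwa [h.loadMatrix_eq_nodeLoad hx] at h1
  · intro h1
    have hx := h.demandMatrix_portions ρ
    refine ⟨_, ?_, hx, fun p => hρ p.1⟩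
    rwa [h.loadMatrix_eq_nodeLoad hx]

end StorageAllocation

theorem filter_div_eq {m n s : ℕ} (hm : 0 < m) (hs : s < n) :
    (Finset.range (m * n)).filter (fun j => j / m = s) = Finset.Ico (s * m) (s * m + m) := by
  ext j
  rw [Finset.mem_filter, Finset.mem_range, Finset.mem_Ico, Nat.div_eq_iff hm]
  have h1 : (s + 1) * m ≤ n * m := Nat.mul_le_mul_right _ hs
  rw [add_one_mul] at h1
  rw [mul_comm m n]
  omega

theorem spacing_nonneg {N : ℕ} {u : Fin N → ℝ} (hu : ∀ l, u l ∈ Set.Icc (0 : ℝ) 1) (i : ℕ) :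
    0 ≤ spacing u i := by
  rw [spacing, sub_nonneg]
  by_cases h : i < N
  · rw [orderStat_succ u h]
    rcases Nat.eq_zero_or_pos i with h0 | h0
    · simpa [orderStat, h0] using (hu _).1
    · obtain ⟨j, rfl⟩ : ∃ j, i = j + 1 := ⟨i - 1, by omega⟩
      rw [orderStat_succ u (by omega)]
      exact Tuple.monotone_sort u (Fin.mk_le_mk.2 (by omega))
  · have : orderStat u (i + 1) = 1 := by simp [orderStat, h]
    rw [this]
    exact orderStat_le_one hu i

theorem window_nonneg {m : ℕ} {d : ℕ → ℝ} (hd : ∀ i, 0 ≤ d i) (i : ℕ) : 0 ≤ window m d i :=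
  Finset.sum_nonneg fun _ _ => hd _

section Demand

variable {m n : ℕ} {A : StorageAllocation n (m * n)} {σ : Fin (m * n) ≃ Fin (m * n)}

/-- When the objects are numbered node by node, the load of a node is a window of spacings. -/
theorem nodeLoad_spacingDemand (hm : 0 < m)
    (hσ : ∀ (s : Fin n) (i : Fin (m * n)), A.Stores s i ↔ ((σ i : ℕ) / m = (s : ℕ)))
    (Λ : ℝ) (u : ℕ → ℝ) (s : Fin n) :
    A.nodeLoad (spacingDemand (m * n) Λ σ u) s =
      Λ * window m (spacing fun l : Fin (m * n - 1) => u l) (s * m) := by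
  classical
  simp only [StorageAllocation.nodeLoad, hσ, spacingDemand]
  rw [Equiv.sum_comp σ (fun j : Fin (m * n) => if (j : ℕ) / m = (s : ℕ) then
      Λ * spacing (fun l : Fin (m * n - 1) => u l) j else 0),
    Fin.sum_univ_eq_sum_range (fun j => if j / m = (s : ℕ) then
      Λ * spacing (fun l : Fin (m * n - 1) => u l) j else 0), ← Finset.sum_filter,
    filter_div_eq hm s.2, Finset.sum_Ico_eq_sum_range, Nat.add_sub_cancel_left, window,
    Finset.mul_sum]

theorem forall_nodeLoad_lt_iff (hm : 0 < m)
    (hσ : ∀ (s : Fin n) (i : Fin (m * n)), A.Stores s i ↔ ((σ i : ℕ) / m = (s : ℕ)))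
    {Λ : ℝ} (hΛ : 0 < Λ) (u : ℕ → ℝ) (z : ℝ) :
    (∀ s, A.nodeLoad (spacingDemand (m * n) Λ σ u) s < Λ * z) ↔
      spacing (fun l : Fin (m * n - 1) => u l) ∈ windowsLt m (blockStarts m n) z := by
  simp only [nodeLoad_spacingDemand hm hσ, mul_lt_mul_iff_right₀ hΛ, windowsLt, blockStarts,
    Set.mem_ofPred_eq, Finset.forall_mem_image, Finset.mem_range]
  exact ⟨fun h s hs => h ⟨s, hs⟩, fun h s => h s.2⟩

/-- The load imbalance is `n` times the longest aligned window: the demand has only one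
feasible assignment, so that the minimum in its definition is over a single value. -/
theorem loadImbalance_mul_lt_iff (hm : 0 < m) (hn : 0 < n) (hA : A.IsSingleChoice m)
    (hσ : ∀ (s : Fin n) (i : Fin (m * n)), A.Stores s i ↔ ((σ i : ℕ) / m = (s : ℕ)))
    {Λ : ℝ} (hΛ : 0 < Λ) {u : ℕ → ℝ} (hu : ∀ j, u j ∈ Set.Icc (0 : ℝ) 1) (z : ℝ) :
    A.loadImbalance Λ (spacingDemand (m * n) Λ σ u) * m < z ↔
      spacing (fun l : Fin (m * n - 1) => u l) ∈
        windowsLt m (blockStarts m n) (z / (m * n : ℕ)) := by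
  have hsp (i : ℕ) : 0 ≤ spacing (fun l : Fin (m * n - 1) => u l) i :=
    spacing_nonneg (fun l => hu l) i
  have hn' : (0 : ℝ) < n := by exact_mod_cast hn
  have hm' : (0 : ℝ) < m := by exact_mod_cast hm
  rw [← forall_nodeLoad_lt_iff hm hσ hΛ u, StorageAllocation.loadImbalance,
    hA.minMaxLoad_eq (ρ := spacingDemand (m * n) Λ σ u) fun i => mul_nonneg hΛ.le (hsp _)]
  have h1 : ‖A.nodeLoad (spacingDemand (m * n) Λ σ u)‖ / (Λ / n) * m < z ↔
      ‖A.nodeLoad (spacingDemand (m * n) Λ σ u)‖ < Λ * (z / (m * n : ℕ)) := by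
    push_cast
    rw [div_mul_eq_mul_div, div_lt_iff₀ (by positivity), ← lt_div_iff₀ hm']
    rw [show z * (Λ / n) / m = Λ * (z / (m * n)) by field_simp]
  have h0 (s : Fin n) : 0 ≤ A.nodeLoad (spacingDemand (m * n) Λ σ u) s := by
    rw [nodeLoad_spacingDemand hm hσ]
    exact mul_nonneg hΛ.le (window_nonneg hsp _)
  rw [h1]
  constructor
  · intro h s
    exact (le_abs_self _).trans_lt ((norm_le_pi_norm _ s).trans_lt h)
  · intro h
    refine (pi_norm_lt_iff ((h0 ⟨0, hn⟩).trans_lt (h ⟨0, hn⟩))).2 fun s => ?_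
    rw [Real.norm_of_nonneg (h0 s)]
    exact h s

end Demand

/-! ### The law of the demand vector and the robustness -/

section Law

variable {Ω : Type*} [MeasurableSpace Ω] {P : Measure Ω} {U : ℕ → Ω → ℝ}

theorem map_points_eq_uniformCube (hU_meas : ∀ j, Measurable (U j))
    (hU_unif : ∀ j, Measure.map (U j) P = volume.restrict (Set.Icc (0 : ℝ) 1))
    (hU_indep : iIndepFun U P) (N : ℕ) :
    Measure.map (fun ω (l : Fin N) => U l ω) P = uniformCube N := by
  have h1 := hU_indep.precomp (g := fun l : Fin N => (l : ℕ)) Fin.val_injective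
  have h2 := iIndepFun.map_fun_eq_pi_map (fun l : Fin N => (hU_meas l).aemeasurable) h1
  rw [h2]
  simp only [hU_unif]
  rw [uniformCube, volume_pi, Measure.restrict_pi_pi]

theorem ae_mem_Icc (hU_meas : ∀ j, Measurable (U j))
    (hU_unif : ∀ j, Measure.map (U j) P = volume.restrict (Set.Icc (0 : ℝ) 1)) :
    ∀ᵐ ω ∂P, ∀ j, U j ω ∈ Set.Icc (0 : ℝ) 1 := by
  refine ae_all_iff.2 fun j => ?_
  refine ae_of_ae_map (hU_meas j).aemeasurable ?_
  rw [hU_unif]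
  exact ae_restrict_mem measurableSet_Icc

theorem map_spacing_mul_eq_uniformDemand {k : ℕ} (hk : 0 < k) {Λ : ℝ} (hΛ : 0 < Λ)
    (σ : Fin k ≃ Fin k) :
    Measure.map (fun (u : Fin (k - 1) → ℝ) (i : Fin k) => Λ * spacing u (σ i))
      (uniformCube (k - 1)) = uniformDemand k Λ := by
  obtain ⟨N, rfl⟩ : ∃ N, k = N + 1 := ⟨k - 1, by omega⟩
  exact map_spacingDemand_eq_uniformDemand hΛ σ

theorem measurable_spacing_mul {k : ℕ} (Λ : ℝ) (σ : Fin k ≃ Fin k) :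
    Measurable fun (u : Fin (k - 1) → ℝ) (i : Fin k) => Λ * spacing u (σ i) :=
  measurable_pi_iff.2 fun i => (measurable_spacing (σ i : ℕ)).const_mul Λ

theorem map_spacingDemand (hU_meas : ∀ j, Measurable (U j))
    (hlaw : ∀ N, Measure.map (fun ω (l : Fin N) => U l ω) P = uniformCube N) {k : ℕ} (hk : 0 < k)
    {Λ : ℝ} (hΛ : 0 < Λ) (σ : Fin k ≃ Fin k) :
    Measure.map (fun ω => spacingDemand k Λ σ fun j => U j ω) P = uniformDemand k Λ := by
  rw [← map_spacing_mul_eq_uniformDemand hk hΛ σ, ← hlaw, Measure.map_map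
    (measurable_spacing_mul Λ σ) (measurable_pi_iff.2 fun l => hU_meas l)]
  rfl

end Law

/-- The robustness is the probability that all aligned windows are shorter than `1 / Λ`. -/
theorem robustness_eq_blockProb {m n : ℕ} (hm : 0 < m) (hn : 0 < n)
    {A : StorageAllocation n (m * n)} (hA : A.IsSingleChoice m) {σ : Fin (m * n) ≃ Fin (m * n)}
    (hσ : ∀ (s : Fin n) (i : Fin (m * n)), A.Stores s i ↔ ((σ i : ℕ) / m = (s : ℕ)))
    {Λ : ℝ} (hΛ : 0 < Λ) : A.robustness Λ = blockProb m n (1 / Λ) := by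
  classical
  set B : Set (Fin (m * n) → ℝ) := {ρ | ∀ s, A.nodeLoad ρ s < 1} with hB
  have hBm : MeasurableSet B := by
    refine measurableSet_forall fun s => measurableSet_lt ?_ measurable_const
    refine Finset.measurable_sum _ fun i _ => ?_
    split_ifs
    · exact measurable_pi_apply i
    · exact measurable_const
  have hset : A.capacityRegion ∩ demandSimplex (m * n) Λ = demandSimplex (m * n) Λ ∩ B := by
    ext ρ
    rw [Set.inter_comm]
    exact and_congr_right fun h => hA.mem_capacityRegion_iff h.1
  have h1 : A.robustness Λ = (uniformDemand (m * n) Λ).real B := by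
    rw [StorageAllocation.robustness, hset, uniformDemand, Measure.real, Measure.real, Measure.real,
      ProbabilityTheory.cond_apply (measurableSet_demandSimplex _ _), ENNReal.toReal_mul,
      ENNReal.toReal_inv, div_eq_inv_mul]
  rw [h1, ← map_spacing_mul_eq_uniformDemand (Nat.mul_pos hm hn) hΛ σ, Measure.real,
    Measure.map_apply (measurable_spacing_mul Λ σ) hBm, blockProb, Measure.real]
  congr 2
  ext u
  set u' : ℕ → ℝ := fun j => if h : j < m * n - 1 then u ⟨j, h⟩ else 0
  have hu' : (fun l : Fin (m * n - 1) => u' l) = u := funext fun l => dif_pos l.2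
  have hd : spacingDemand (m * n) Λ σ u' = fun i => Λ * spacing u (σ i) := by
    unfold spacingDemand
    rw [hu']
  have h2 := forall_nodeLoad_lt_iff hm hσ hΛ u' (1 / Λ)
  rw [mul_one_div_cancel hΛ.ne', hd, hu'] at h2
  exact h2


/-! ### Thresholds away from the Gumbel window -/

theorem blockProb_mono (m n : ℕ) {t t' : ℝ} (h : t ≤ t') : blockProb m n t ≤ blockProb m n t' :=
  measureReal_mono fun _ hu => windowsLt_mono h hu

theorem tendsto_blockProb_one (N : ℕ) {z : ℕ → ℝ}
    (hz : ∀ x : ℝ, ∀ᶠ n : ℕ in atTop, Real.log n + centering (N + 1) n + x ≤ z n) :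
    Tendsto (fun n : ℕ => blockProb (N + 1) n (z n / ((N + 1) * n : ℕ))) atTop (𝓝 1) := by
  have hlim : Tendsto (fun x : ℝ => Real.exp (-Real.exp (-x))) atTop (𝓝 1) := by
    have h := (Real.continuous_exp.tendsto _).comp (Real.tendsto_exp_neg_atTop_nhds_zero.neg)
    simpa [Function.comp_def] using h
  refine tendsto_order.2 ⟨fun a ha => ?_, fun a ha => Eventually.of_forall fun n =>
    (measureReal_le_one).trans_lt ha⟩
  obtain ⟨x, hx⟩ := (hlim.eventually_const_lt ha).exists
  have h1 := tendsto_blockProb N (z := fun n => Real.log n + centering (N + 1) n + x) (x := x)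
    (tendsto_const_nhds.congr fun n => by ring)
  filter_upwards [h1.eventually_const_lt hx, hz x] with n h2 h3
  exact h2.trans_le (blockProb_mono _ _ (div_le_div_of_nonneg_right h3 (Nat.cast_nonneg _)))

theorem tendsto_blockProb_zero (N : ℕ) {z : ℕ → ℝ}
    (hz : ∀ x : ℝ, ∀ᶠ n : ℕ in atTop, z n ≤ Real.log n + centering (N + 1) n + x) :
    Tendsto (fun n : ℕ => blockProb (N + 1) n (z n / ((N + 1) * n : ℕ))) atTop (𝓝 0) := by
  have hlim : Tendsto (fun x : ℝ => Real.exp (-Real.exp (-x))) atBot (𝓝 0) :=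
    Real.tendsto_exp_neg_atTop_nhds_zero.comp (Real.tendsto_exp_atTop.comp tendsto_neg_atBot_atTop)
  refine tendsto_order.2 ⟨fun a ha => Eventually.of_forall fun n =>
    ha.trans_le measureReal_nonneg, fun a ha => ?_⟩
  obtain ⟨x, hx⟩ := (hlim.eventually_lt_const ha).exists
  have h1 := tendsto_blockProb N (z := fun n => Real.log n + centering (N + 1) n + x) (x := x)
    (tendsto_const_nhds.congr fun n => by ring)
  filter_upwards [h1.eventually_lt_const hx, hz x] with n h2 h3
  exact (blockProb_mono _ _ (div_le_div_of_nonneg_right h3 (Nat.cast_nonneg _))).trans_lt h2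

theorem eventually_abs_centering_add_le (m : ℕ) (x : ℝ) {δ : ℝ} (hδ : 0 < δ) :
    ∀ᶠ n : ℕ in atTop, 0 < Real.log n ∧ |centering m n + x| ≤ δ * Real.log n := by
  have h := ((tendsto_centering_div_log m).add
    ((tendsto_const_nhds (x := x)).div_atTop tendsto_log_natCast_atTop)).abs
  rw [add_zero, abs_zero] at h
  filter_upwards [h.eventually_le_const hδ, tendsto_log_natCast_atTop.eventually_gt_atTop 0]
    with n h1 h2
  rw [← add_div, abs_div, abs_of_pos h2, div_le_iff₀ h2] at h1
  exact ⟨h2, h1⟩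

/-- At load `b n / log n` the threshold for the longest window is `(m / b) log n`, to be compared
with its typical size `log n`. -/
theorem tendsto_blockProb_load (N : ℕ) {b : ℕ → ℝ} (hb : ∀ n, 0 < b n) :
    (limsup (fun n => (b n : EReal)) atTop < (((N + 1 : ℕ) : ℝ) : EReal) →
      Tendsto (fun n : ℕ => blockProb (N + 1) n (1 / (b n * (n / Real.log n)))) atTop (𝓝 1)) ∧
    ((((N + 1 : ℕ) : ℝ) : EReal) < liminf (fun n => (b n : EReal)) atTop →
      Tendsto (fun n : ℕ => blockProb (N + 1) n (1 / (b n * (n / Real.log n)))) atTop (𝓝 0)) := by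
  have hm : (0 : ℝ) < ((N + 1 : ℕ) : ℝ) := by positivity
  have hz : ∀ᶠ n : ℕ in atTop, ((N + 1 : ℕ) : ℝ) / b n * Real.log n / ((N + 1) * n : ℕ) =
      1 / (b n * (n / Real.log n)) := by
    filter_upwards [eventually_gt_atTop 0, tendsto_log_natCast_atTop.eventually_gt_atTop 0]
      with n hn hlog
    have hn' : (n : ℝ) ≠ 0 := by positivity
    have := (hb n).ne'
    rw [Nat.cast_mul]
    field_simp
  constructor
  · intro h
    obtain ⟨c, hc1, hc2⟩ := EReal.lt_iff_exists_real_btwn.1 h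
    have hcm : c < ((N + 1 : ℕ) : ℝ) := EReal.coe_lt_coe_iff.1 hc2
    have hbc : ∀ᶠ n in atTop, b n < c :=
      (eventually_lt_of_limsup_lt hc1).mono fun n hn => EReal.coe_lt_coe_iff.1 hn
    have hc0 : 0 < c := by
      obtain ⟨n, hn⟩ := hbc.exists
      exact (hb n).trans hn
    have hδ : 0 < ((N + 1 : ℕ) : ℝ) / c - 1 := sub_pos.2 ((one_lt_div hc0).2 hcm)
    refine (tendsto_blockProb_one N (z := fun n => ((N + 1 : ℕ) : ℝ) / b n * Real.log n)
      fun x => ?_).congr' (hz.mono fun n hn => by rw [hn])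
    filter_upwards [hbc, eventually_abs_centering_add_le (N + 1) x hδ] with n h1 ⟨h2, h3⟩
    have h4 : ((N + 1 : ℕ) : ℝ) / c ≤ ((N + 1 : ℕ) : ℝ) / b n :=
      div_le_div_of_nonneg_left hm.le (hb n) h1.le
    have h5 := mul_le_mul_of_nonneg_right h4 h2.le
    have h6 := (abs_le.1 h3).2
    linarith
  · intro h
    obtain ⟨c, hc1, hc2⟩ := EReal.lt_iff_exists_real_btwn.1 h
    have hcm : ((N + 1 : ℕ) : ℝ) < c := EReal.coe_lt_coe_iff.1 hc1
    have hbc : ∀ᶠ n in atTop, c < b n :=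
      (eventually_lt_of_lt_liminf hc2).mono fun n hn => EReal.coe_lt_coe_iff.1 hn
    have hc0 : 0 < c := hm.trans hcm
    have hδ : 0 < 1 - ((N + 1 : ℕ) : ℝ) / c := sub_pos.2 ((div_lt_one hc0).2 hcm)
    refine (tendsto_blockProb_zero N (z := fun n => ((N + 1 : ℕ) : ℝ) / b n * Real.log n)
      fun x => ?_).congr' (hz.mono fun n hn => by rw [hn])
    filter_upwards [hbc, eventually_abs_centering_add_le (N + 1) x hδ] with n h1 ⟨h2, h3⟩
    have h4 : ((N + 1 : ℕ) : ℝ) / b n ≤ ((N + 1 : ℕ) : ℝ) / c :=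
      div_le_div_of_nonneg_left hm.le hc0 h1.le
    have h5 := mul_le_mul_of_nonneg_right h4 h2.le
    have h6 := (abs_le.1 h3).1
    linarith

/-- A sequence eventually confined to `[(1 - ε) log n, (1 + 2 ε) log n)` for arbitrarily small `ε`
is asymptotic to `log n`. -/
theorem tendsto_sub_centering_div_log (m : ℕ) {X : ℕ → ℝ}
    (hX : ∀ q : ℕ, ∀ᶠ n : ℕ in atTop, (1 - 1 / ((q : ℝ) + 1)) * Real.log n ≤ X n ∧
      X n < (1 + 2 * (1 / ((q : ℝ) + 1))) * Real.log n) :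
    Tendsto (fun n => (X n - centering m n) / Real.log n) atTop (𝓝 1) := by
  have h1 : Tendsto (fun n => X n / Real.log n) atTop (𝓝 1) := by
    have hq := tendsto_one_div_add_atTop_nhds_zero_nat (𝕜 := ℝ)
    have hlo := hq.const_sub 1
    have hup := (hq.const_mul 2).const_add 1
    rw [sub_zero] at hlo
    rw [mul_zero, add_zero] at hup
    refine tendsto_order.2 ⟨fun a ha => ?_, fun a ha => ?_⟩
    · obtain ⟨q, hq⟩ := (hlo.eventually_const_lt ha).exists
      filter_upwards [hX q, tendsto_log_natCast_atTop.eventually_gt_atTop 0] with n hn hlog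
      exact hq.trans_le ((le_div_iff₀ hlog).2 hn.1)
    · obtain ⟨q, hq⟩ := (hup.eventually_lt_const ha).exists
      filter_upwards [hX q, tendsto_log_natCast_atTop.eventually_gt_atTop 0] with n hn hlog
      exact ((div_lt_iff₀ hlog).2 hn.2).trans hq
  have h2 := h1.sub (tendsto_centering_div_log m)
  rw [sub_zero] at h2
  exact h2.congr fun n => (sub_div _ _ _).symm

end

theorem mainTheorem3 (m : ℕ) (hm : 1 ≤ m)
    (A : (n : ℕ) → StorageAllocation n (m * n))
    (hA : ∀ n, (A n).IsSingleChoice m)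
    (σ : (n : ℕ) → Fin (m * n) ≃ Fin (m * n))
    (hσ : ∀ (n : ℕ) (s : Fin n) (i : Fin (m * n)),
      (A n).Stores s i ↔ ((σ n i : ℕ) / m = (s : ℕ)))
    (Λ : ℕ → ℝ) (hΛ : ∀ n, 0 < Λ n)
    {Ω : Type*} [MeasurableSpace Ω] (P : Measure Ω) [IsProbabilityMeasure P]
    (U : ℕ → Ω → ℝ) (hU_meas : ∀ j, Measurable (U j))
    (hU_unif : ∀ j, Measure.map (U j) P = volume.restrict (Set.Icc (0 : ℝ) 1))
    (hU_indep : iIndepFun U P) :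
    -- the random demand vectors are uniformly distributed on the simplex
    (∀ n, 1 ≤ n →
      Measure.map (fun ω => spacingDemand (m * n) (Λ n) (σ n) (fun j => U j ω)) P =
        uniformDemand (m * n) (Λ n)) ∧
    -- convergence of the load imbalance in distribution to the standard Gumbel law
    (∀ x : ℝ, Tendsto
      (fun n : ℕ => P.real {ω |
        (A n).loadImbalance (Λ n) (spacingDemand (m * n) (Λ n) (σ n) (fun j => U j ω)) * m
          - Real.log n - centering m n < x})
      atTop (𝓝 (Real.exp (-Real.exp (-x))))) ∧
    -- almost sure convergence of the load imbalance
    (∀ᵐ ω ∂P, Tendsto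
      (fun n : ℕ =>
        ((A n).loadImbalance (Λ n) (spacingDemand (m * n) (Λ n) (σ n) (fun j => U j ω)) * m
          - centering m n) / Real.log n)
      atTop (𝓝 1)) ∧
    -- robustness
    (∀ b : ℕ → ℝ, (∀ n, 0 < b n) →
      (limsup (fun n => (b n : EReal)) atTop < ((m : ℝ) : EReal) →
        Tendsto (fun n : ℕ => (A n).robustness (b n * (n / Real.log n))) atTop (𝓝 1)) ∧
      (((m : ℝ) : EReal) < liminf (fun n => (b n : EReal)) atTop →
        Tendsto (fun n : ℕ => (A n).robustness (b n * (n / Real.log n))) atTop (𝓝 0))) := by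
  obtain ⟨N, rfl⟩ : ∃ N, m = N + 1 := ⟨m - 1, by omega⟩
  have hlaw := map_points_eq_uniformCube hU_meas hU_unif hU_indep
  have hU01 := ae_mem_Icc hU_meas hU_unif
  refine ⟨fun n hn => map_spacingDemand hU_meas hlaw (Nat.mul_pos hm hn) (hΛ n) (σ n),
    fun x => ?_, ?_, fun b hb => ?_⟩
  · refine (tendsto_blockProb N (z := fun n => Real.log n + centering (N + 1) n + x) (x := x)
      (tendsto_const_nhds.congr fun n => by ring)).congr' ?_
    filter_upwards [eventually_gt_atTop 0] with n hn
    rw [blockProb, ← measureReal_spacing_windowsLt hU_meas hlaw]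
    refine measureReal_congr ?_
    filter_upwards [hU01] with ω hω
    have h := loadImbalance_mul_lt_iff hm hn (hA n) (hσ n) (hΛ n) hω
      (Real.log n + centering (N + 1) n + x)
    refine propext (h.symm.trans ?_)
    change _ ↔ _ - Real.log n - centering (N + 1) n < x
    constructor <;> intro h' <;> linarith
  · have hlow : ∀ᵐ ω ∂P, ∀ q : ℕ, ∀ᶠ n : ℕ in atTop,
        spacing (fun l : Fin ((N + 1) * n - 1) => U l ω) ∉ windowsLt (N + 1)
          (blockStarts (N + 1) n) ((1 - 1 / ((q : ℝ) + 1)) * Real.log n / ((N + 1) * n : ℕ)) :=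
      ae_all_iff.2 fun q => ae_eventually_notMem_windowsLt hU_meas hlaw N (by positivity)
        ((div_le_one (by positivity)).2 (le_add_of_nonneg_left (Nat.cast_nonneg q)))
    have hup : ∀ᵐ ω ∂P, ∀ q : ℕ, ∀ᶠ n : ℕ in atTop,
        spacing (fun l : Fin ((N + 1) * n - 1) => U l ω) ∈ windowsLt (N + 1)
          (blockStarts (N + 1) n)
          ((1 + 2 * (1 / ((q : ℝ) + 1))) * Real.log n / ((N + 1) * n : ℕ)) :=
      ae_all_iff.2 fun q => ae_eventually_mem_windowsLt hU_meas hU01 hlaw N (by positivity)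
        ((div_le_one (by positivity)).2 (le_add_of_nonneg_left (Nat.cast_nonneg q)))
    filter_upwards [hU01, hlow, hup] with ω hω h1 h2
    refine tendsto_sub_centering_div_log (N + 1) fun q => ?_
    filter_upwards [h1 q, h2 q, eventually_gt_atTop 0] with n h3 h4 hn
    have h := loadImbalance_mul_lt_iff hm hn (hA n) (hσ n) (hΛ n) hω
    exact ⟨not_lt.1 fun h' => h3 ((h _).1 h'), (h _).2 h4⟩
  · have hrob : ∀ᶠ n : ℕ in atTop, blockProb (N + 1) n (1 / (b n * (n / Real.log n))) =
        (A n).robustness (b n * (n / Real.log n)) := by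
      filter_upwards [eventually_gt_atTop 0, tendsto_log_natCast_atTop.eventually_gt_atTop 0]
        with n hn hlog
      have hn' : (0 : ℝ) < n := by exact_mod_cast hn
      exact (robustness_eq_blockProb hm hn (hA n) (hσ n)
        (mul_pos (hb n) (div_pos hn' hlog))).symm
    have h := tendsto_blockProb_load N hb
    exact ⟨fun hl => (h.1 hl).congr' hrob, fun hl => (h.2 hl).congr' hrob⟩
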